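/- **Setting.** Let $p\ge 1$ and $n$ be natural numbers and $c\ge 40$ a real constant. Put $$\gamma=c\sqrt{\tfrac{\ln n}{n}},\quad k=\Big\lfloor (0.1/\gamma)^{2/3}\Big\rfloor,\quad \alpha=p+1,\quad \rho=\frac{\gamma}{100\,\alpha\ln n},\quad \beta=\frac{\gamma}{\ln n},\quad \epsilon=\frac{0.1}{\sqrt k}$$ (with $k=0$ for $n\le 1$; the claims below are empty when $k=0$). For orthonormal $V=(v_1,\dots,v_k)$ in $\mathbb R^n$ define, for $1\le i\le k$, $$f_i(x)=\rho\ln\Big(\sum_{j=1}^{i}\exp\Big(\frac{\langle v_j,x\rangle+(k-j)\gamma}{\rho}\Big)\Big)+\rho(k-i)n^{-\alpha},\qquad h=\max_{1\le i\le k}f_i,$$ $$g=g_V=S_{\beta/2^{p}}\big[S_{\beta/2^{p-1}}[\cdots S_{\beta/2}[h]\cdots]\big],$$ where $S_\eta[f](x)$ is the average of $f$ over the ball of radius $\eta$ around $x$. Let $V$ be Haar random (the first $k$ columns of a Haar random orthogonal matrix). An algorithm has access to the $p$-th order oracle $x\mapsto(g(x),\nabla g(x),\dots,\nabla^p g(x))$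 at points $x$ of the closed unit ball $B$ of $\mathbb R^n$. It succeeds on $g$ if it outputs a point $x\in B$ with $g(x)-\min_{B}g\le\epsilon$. Its success probability is taken over $V$ and over its own randomness (hence the bounds below apply in particular to algorithms that succeed with the stated probability on every $g_V$). * A parallel randomized algorithm with $r$ rounds of $K$ queries draws a random seed; in each round it makes $K$ queries, which depend measurably on the seed and on the answers in the earlier rounds, and after the last round it outputs a point that depends measurably on the seed and on all answers. * A $t$-query quantum algorithm acts on finitely many basis states $|x,a,w\rangle$, where $x$ encodes a point of $B$, $a$ lies in a finite abelian group and $w$ is a workspace. It prepares $U_tO_gU_{t-1}O_g\cdots U_1O_gU_0|\mathrm{start}\rangle$ with unitaries $U_j$ that do not depend on $g$ and with $O_g|x,a,w\rangle=|x,a+\mathrm{enc}(\text{oracle answer at }x),w\rangle$, measures all registers and translates the outcome into a point of $B$. The registers, the finite encoding of the points and the (measurable) finite-precision encoding $\mathrm{enc}$ of the answers are arbitrary. **Corollary.** 1. Let $c=40$. For all $p\ge1$, $n$ and $K\ge 1$, every parallel randomized algorithm with $K$ queries per round whose success probability is larger than $Kn^{-9}$ uses at least $k$ rounds. (So $k$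 rounds are needed for any constant success probability when $Kn^{-9}\ll1$.) 2. By changing the constant in $\gamma$, $K$ may be any polynomial in $n$: for every $d\in\mathbb N$ there is a constant $c\ge40$, depending only on $d$, such that for all $p\ge1$, $n$ and $K\ge 1$, every parallel randomized algorithm with $K$ queries per round whose success probability is larger than $Kn^{-d}$ uses at least $k$ rounds. 3. Let $c=40$. For all $p\ge1$ and $n$, every quantum algorithm whose success probability is larger than $n^{-4}$ makes at least $k$ queries. -/

import Mathlib

open MeasureTheory Set
open scoped ENNReal

noncomputable section

namespace SmoothLB

/-- Euclidean space of dimension `n`. -/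
abbrev E (n : ℕ) : Type := EuclideanSpace ℝ (Fin n)

/-- The closed unit ball of `E n`: the set of admissible queries and of admissible outputs. -/
abbrev Ball (n : ℕ) : Type := Metric.closedBall (0 : E n) 1

/-! ### The parameters -/

/-- `γ = c √(ln n / n)`. -/
def gam (c : ℝ) (n : ℕ) : ℝ := c * Real.sqrt (Real.log n / n)

/-- `k = ⌊(0.1 / γ) ^ (2/3)⌋`. -/
def steps (c : ℝ) (n : ℕ) : ℕ := ⌊((1 / 10) / gam c n) ^ ((2 : ℝ) / 3)⌋₊

/-- `α = p + 1`. -/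
def alph (p : ℕ) : ℝ := p + 1

/-- `ρ = γ / (100 α ln n)`. -/
def rho (c : ℝ) (p n : ℕ) : ℝ := gam c n / (100 * alph p * Real.log n)

/-- `β = γ / ln n`. -/
def bet (c : ℝ) (n : ℕ) : ℝ := gam c n / Real.log n

/-- `ε = 0.1 / √k`. -/
def eps (c : ℝ) (n : ℕ) : ℝ := (1 / 10) / Real.sqrt (steps c n)

/-! ### The hard functions

Indices in `Fin k` start at `0`, so that `i : Fin k` stands for the index `i + 1 ∈ {1, …, k}`. -/

/-- `vec_V(x) = (⟨v₁, x⟩ + (k-1)γ, ⟨v₂, x⟩ + (k-2)γ, …, ⟨v_k, x⟩)`. -/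
def vecV {n k : ℕ} (γ : ℝ) (V : Fin k → E n) (x : E n) : Fin k → ℝ :=
  fun j => inner ℝ (V j) x + ((k : ℝ) - ((j : ℝ) + 1)) * γ

/-- The softmax with parameter `ρ` of the coordinates of `z` up to the index `i`, inclusive. -/
def smaxLE {k : ℕ} (ρ : ℝ) (i : Fin k) (z : Fin k → ℝ) : ℝ :=
  ρ * Real.log (∑ j ∈ Finset.Iic i, Real.exp (z j / ρ))

/-- `f_i(x) = smax_ρ^{≤ i}(vec_V(x)) + ρ (k - i) n^{-α}`. -/
def fPiece {n k : ℕ} (γ ρ α : ℝ) (V : Fin k → E n) (i : Fin k) (x : E n) : ℝ :=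
  smaxLE ρ i (vecV γ V x) + ρ * ((k : ℝ) - ((i : ℝ) + 1)) * (n : ℝ) ^ (-α)

/-- `h(x) = max_i f_i(x)`. -/
def hMax {n k : ℕ} (γ ρ α : ℝ) (V : Fin k → E n) (x : E n) : ℝ :=
  ⨆ i : Fin k, fPiece γ ρ α V i x

/-- Randomized smoothing: the average of `f` over the ball of radius `η` around `x`. -/
def ballSmooth {n : ℕ} (η : ℝ) (f : E n → ℝ) (x : E n) : ℝ :=
  ⨍ y in Metric.closedBall x η, f y

/-- `S[f] = S_{β/2^p}[ ⋯ S_{β/2^2}[S_{β/2^1}[f]] ⋯ ]`, with `p` rounds of smoothing. -/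
def smoothing {n : ℕ} (β : ℝ) : ℕ → (E n → ℝ) → (E n → ℝ)
  | 0, f => f
  | p + 1, f => ballSmooth (β / 2 ^ (p + 1)) (smoothing β p f)

/-- The hard function `g = S[h]` attached to the list `V` of vectors. -/
def hardFun (c : ℝ) (p n : ℕ) (V : Fin (steps c n) → E n) : E n → ℝ :=
  smoothing (bet c n) p (hMax (gam c n) (rho c p n) (alph p) V)

/-- `x` is an `ε`-approximate minimum of `f` over the unit ball. -/
def IsEpsOptimal {n : ℕ} (ε : ℝ) (f : E n → ℝ) (x : Ball n) : Prop :=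
  ∀ y : Ball n, f x - f y ≤ ε

/-! ### Haar random orthonormal vectors -/

instance orthogonalMeasurableSpace (n : ℕ) :
    MeasurableSpace (Matrix.orthogonalGroup (Fin n) ℝ) := borel _

instance orthogonalBorelSpace (n : ℕ) : BorelSpace (Matrix.orthogonalGroup (Fin n) ℝ) := ⟨rfl⟩

instance orthogonalCompactSpace (n : ℕ) : CompactSpace (Matrix.orthogonalGroup (Fin n) ℝ) := by
  refine isCompact_iff_compactSpace.mp ?_
  have hK : IsCompact (Set.pi Set.univ fun _ : Fin n => Set.pi Set.univ fun _ : Fin n =>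
      Metric.closedBall (0 : ℝ) 1) :=
    isCompact_univ_pi fun _ => isCompact_univ_pi fun _ => isCompact_closedBall 0 1
  refine IsCompact.of_isClosed_subset (X := Matrix (Fin n) (Fin n) ℝ) hK ?_ ?_
  · have : (↑(Matrix.orthogonalGroup (Fin n) ℝ) : Set (Matrix (Fin n) (Fin n) ℝ)) =
        {A | A * star A = 1} := by
      ext A
      exact Matrix.mem_orthogonalGroup_iff (Fin n) ℝ
    rw [this]
    exact isClosed_eq (by fun_prop) continuous_const
  · intro A hA i _ j _
    simpa using entry_norm_bound_of_unitary hA i j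

/-- The normalized Haar measure of the orthogonal group. -/
def haarOrthogonal (n : ℕ) : Measure (Matrix.orthogonalGroup (Fin n) ℝ) :=
  Measure.haarMeasure ⊤

/-- The first `k` columns of an orthogonal matrix. They make sense for `k ≤ n`, which is the only
case that occurs below; missing columns are set to zero. -/
def columns (n k : ℕ) (A : Matrix.orthogonalGroup (Fin n) ℝ) : Fin k → E n :=
  fun j => if h : (j : ℕ) < n then WithLp.toLp 2 (fun a => A.1 a ⟨j, h⟩) else 0

/-- The law of `k` Haar random orthonormal vectors of `E n`: the law of the first `k` columns of a
Haar random orthogonal matrix. -/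
def haarFrame (n k : ℕ) : Measure (Fin k → E n) :=
  (haarOrthogonal n).map (columns n k)

theorem measurable_columns (n k : ℕ) : Measurable (columns n k) := by
  refine measurable_pi_lambda _ fun j => Continuous.measurable ?_
  by_cases h : (j : ℕ) < n
  · simp only [columns, h, dite_true]
    refine (PiLp.continuous_toLp 2 (fun _ : Fin n => ℝ)).comp (continuous_pi fun a => ?_)
    exact Continuous.matrix_elem continuous_subtype_val a (⟨j, h⟩ : Fin n)
  · simp only [columns, h, dite_false]
    exact continuous_const

instance haarOrthogonal_isProbabilityMeasure (n : ℕ) :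
    IsProbabilityMeasure (haarOrthogonal n) := by
  constructor
  have h := Measure.haarMeasure_self
    (K₀ := (⊤ : TopologicalSpace.PositiveCompacts (Matrix.orthogonalGroup (Fin n) ℝ)))
  simpa [haarOrthogonal] using h

instance haarFrame_isProbabilityMeasure (n k : ℕ) : IsProbabilityMeasure (haarFrame n k) :=
  Measure.isProbabilityMeasure_map (measurable_columns n k).aemeasurable

/-! ### The oracle -/

/-- Answers of the `p`-th order oracle: for every order `i ≤ p` the coordinates of the `i`-th
derivative, that is, all its partial derivatives of order `i`. -/
abbrev Answer (p n : ℕ) : Type := (i : Fin (p + 1)) → (Fin i → Fin n) → ℝ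

/-- The `p`-th order oracle `x ↦ (f(x), ∇f(x), …, ∇^p f(x))`. -/
def oracle (p : ℕ) {n : ℕ} (f : E n → ℝ) (x : Ball n) : Answer p n :=
  fun i s => iteratedFDeriv ℝ (i : ℕ) f (x : E n) fun j => EuclideanSpace.single (s j) (1 : ℝ)

/-! ### Parallel randomized algorithms -/

/-- A randomized algorithm with random seed in `Ω` that makes `r` rounds of `K` queries to the
`p`-th order oracle. The `K` queries of a round depend on the seed and on the answers in the earlier
rounds (only the rounds `j < r` are used), the output on the seed and on all the answers. -/
structure ParallelAlgorithm (p n K r : ℕ) (Ω : Type*) [MeasurableSpace Ω] where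
  query : (j : ℕ) → Ω × (Fin j → Fin K → Answer p n) → Fin K → Ball n
  output : Ω × (Fin r → Fin K → Answer p n) → Ball n
  measurable_query : ∀ j, Measurable (query j)
  measurable_output : Measurable output

namespace ParallelAlgorithm

variable {p n K r : ℕ} {Ω : Type*} [MeasurableSpace Ω]

/-- The answers in the first `j` rounds of a run with seed `ω` on the oracle `F`. -/
def answers (A : ParallelAlgorithm p n K r Ω) (F : Ball n → Answer p n) (ω : Ω) :
    (j : ℕ) → Fin j → Fin K → Answer p n
  | 0 => Fin.elim0
  | j + 1 => Fin.snoc (answers A F ω j) fun l => F (A.query j (ω, answers A F ω j) l)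

/-- The output of a run with seed `ω` on the oracle `F`. -/
def result (A : ParallelAlgorithm p n K r Ω) (F : Ball n → Answer p n) (ω : Ω) : Ball n :=
  A.output (ω, A.answers F ω r)

end ParallelAlgorithm

/-- The probability, over the seed and over Haar random orthonormal vectors `V`, that the algorithm
outputs an `ε`-approximate minimum of the hard function. -/
def ParallelAlgorithm.success {p n K r : ℕ} {Ω : Type*} [MeasurableSpace Ω]
    (A : ParallelAlgorithm p n K r Ω) (P : Measure Ω) (c : ℝ) : ℝ≥0∞ :=
  (P.prod (haarFrame n (steps c n)))
    {z | IsEpsOptimal (eps c n) (hardFun c p n z.2) (A.result (oracle p (hardFun c p n z.2)) z.1)}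

/-! ### Quantum algorithms -/

/-- A quantum query algorithm with access to the `p`-th order oracle, on the Hilbert space with
orthonormal basis `|x, a, w⟩`, where `x : X` is the content of the query register, `a : A` the
content of the answer register and `w : W` the content of the workspace. The registers are finite,
of any size. The algorithm chooses how points of the unit ball are represented in the query register
(`point`) and to which finite precision the answers of the oracle are delivered (`encode`). The
unitary `unitary j` is applied after the `j`-th query (the first one, `unitary 0`, at the start), to
the basis state `start`. In the end all registers are measured and the outcome `z` is translated
into the point `output z`. -/
structure QuantumAlgorithm (p n : ℕ) (X A W : Type) [Fintype X] [DecidableEq X]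
    [Fintype A] [DecidableEq A] [AddCommGroup A] [Fintype W] [DecidableEq W] where
  point : X → Ball n
  encode : Answer p n → A
  measurable_encode : ∀ a, MeasurableSet (encode ⁻¹' {a})
  start : X × A × W
  unitary : ℕ → Matrix.unitaryGroup (X × A × W) ℂ
  output : X × A × W → Ball n

namespace QuantumAlgorithm

variable {p n : ℕ} {X A W : Type} [Fintype X] [DecidableEq X]
  [Fintype A] [DecidableEq A] [AddCommGroup A] [Fintype W] [DecidableEq W]

/-- The permutation `|x, a, w⟩ ↦ |x, a + encode (F x), w⟩` of the basis. -/
def oraclePerm (B : QuantumAlgorithm p n X A W) (F : Ball n → Answer p n) :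
    Equiv.Perm (X × A × W) where
  toFun z := (z.1, z.2.1 + B.encode (F (B.point z.1)), z.2.2)
  invFun z := (z.1, z.2.1 - B.encode (F (B.point z.1)), z.2.2)
  left_inv z := by simp
  right_inv z := by simp

/-- The oracle unitary, which permutes the basis by `oraclePerm`. -/
def oracleUnitary (B : QuantumAlgorithm p n X A W) (F : Ball n → Answer p n)
    (ψ : X × A × W → ℂ) : X × A × W → ℂ :=
  fun z => ψ ((B.oraclePerm F).symm z)

/-- The state `U_t O U_{t-1} O ⋯ O U_0 |start⟩` after `t` queries to the oracle `F`. -/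
def state (B : QuantumAlgorithm p n X A W) (F : Ball n → Answer p n) :
    ℕ → X × A × W → ℂ
  | 0 => Matrix.mulVec (B.unitary 0).1 (Pi.single B.start 1)
  | t + 1 => Matrix.mulVec (B.unitary (t + 1)).1 (B.oracleUnitary F (state B F t))

open Classical in
/-- The probability that the point obtained after `t` queries to the oracle `F` satisfies `good`. -/
def probOf (B : QuantumAlgorithm p n X A W) (F : Ball n → Answer p n) (t : ℕ)
    (good : Ball n → Prop) : ℝ :=
  ∑ z : X × A × W, if good (B.output z) then ‖B.state F t z‖ ^ 2 else 0

/-- The probability, over Haar random orthonormal vectors `V` and over the final measurement, that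
the algorithm outputs an `ε`-approximate minimum of the hard function after `t` queries. -/
def success (B : QuantumAlgorithm p n X A W) (t : ℕ) (c : ℝ) : ℝ≥0∞ :=
  ∫⁻ V, ENNReal.ofReal
    (B.probOf (oracle p (hardFun c p n V)) t (IsEpsOptimal (eps c n) (hardFun c p n V)))
    ∂(haarFrame n (steps c n))

end QuantumAlgorithm

end SmoothLB

end

open SmoothLB

noncomputable section

namespace SmoothLB

/-! ### Invariance of the Haar measure and columns of orthogonal matrices -/

/-! The vectors can be discovered only one per round. If `x` has inner product at most `γ/4` in
absolute value with `v_l` for every index `l ≥ m` (counted from `0`), then near `x` the pieces of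
`h` beyond the `m`-th are dominated by the `m`-th one: the shifts `(k-j)γ` make the later terms of
the softmax negligible, and the offsets `ρ(k-i)n^{-α}` outweigh what remains. The smoothing never
looks farther than `β`, so the whole oracle answer at `x` is unchanged when the vectors after index
`m` are set to zero (`oracle_hardFun_truncV`).

Compare a run with a hybrid run whose `j`-th round is answered from the first `j+1` vectors only.
Its queries in round `j` depend on the first `j` vectors. A vector of index at least `j` has inner
product above `γ/4` with such a query with probability at most `tailBound`, about `n^{-c²/64}`
(`lintegral_indicator_inner_gam_le`). Outside these rare events both runs coincide. With fewer than
`k` rounds the output does not depend on the last vector, hence is nearly orthogonal to it, and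
`not_isEpsOptimal_hardFun` shows that it is not `ε`-optimal. A union bound finishes the parallel
case.

In the quantum case the same comparison is made on states: the distance between true and hybrid
state is bounded by the amplitude that the hybrid states put on query points where the two oracles
differ (`stateNorm_state_sub_hybridState_le`). These squared amplitudes depend on the frame
themselves, but only on its first `j` vectors, so the tail bound is proved with a weight of that
kind.

The tail bound needs no geometry of the sphere: by right invariance a fresh column may be replaced
by a random sign combination of the columns not yet revealed, and the moment becomes a product of
hyperbolic cosines. -/

instance haarOrthogonal_isMulLeftInvariant (n : ℕ) : (haarOrthogonal n).IsMulLeftInvariant := by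
  unfold haarOrthogonal; infer_instance

instance orthogonalSecondCountableTopology (n : ℕ) :
    SecondCountableTopology (Matrix.orthogonalGroup (Fin n) ℝ) := by
  have : SecondCountableTopology (Matrix (Fin n) (Fin n) ℝ) :=
    inferInstanceAs (SecondCountableTopology (Fin n → Fin n → ℝ))
  exact TopologicalSpace.Subtype.secondCountableTopology _

/-- A right translate of the Haar measure is again left invariant with total mass one, so uniqueness
applies. Right multiplication is the side that recombines columns. -/
instance haarOrthogonal_isMulRightInvariant (n : ℕ) : (haarOrthogonal n).IsMulRightInvariant := by
  refine ⟨fun g => ?_⟩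
  have : IsProbabilityMeasure ((haarOrthogonal n).map (· * g)) :=
    Measure.isProbabilityMeasure_map (measurable_mul_const g).aemeasurable
  have h := Measure.haarMeasure_unique ((haarOrthogonal n).map (· * g))
    (⊤ : TopologicalSpace.PositiveCompacts (Matrix.orthogonalGroup (Fin n) ℝ))
  rw [h]
  have : ((haarOrthogonal n).map (· * g))
      ((⊤ : TopologicalSpace.PositiveCompacts (Matrix.orthogonalGroup (Fin n) ℝ)) : Set _) = 1 := by
    rw [TopologicalSpace.PositiveCompacts.coe_top, measure_univ]
  rw [this, one_smul]; rfl

/-- The `l`-th column of an orthogonal matrix. -/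
def col {n : ℕ} (A : Matrix.orthogonalGroup (Fin n) ℝ) (l : Fin n) : E n :=
  WithLp.toLp 2 (fun a => A.1 a l)

theorem measurable_col {n : ℕ} (l : Fin n) : Measurable fun A => col (n := n) A l := by
  refine Continuous.measurable ?_
  refine (PiLp.continuous_toLp 2 (fun _ : Fin n => ℝ)).comp (continuous_pi fun a => ?_)
  exact Continuous.matrix_elem continuous_subtype_val a l

theorem orthonormal_col {n : ℕ} (A : Matrix.orthogonalGroup (Fin n) ℝ) :
    Orthonormal ℝ (col A) := by
  rw [orthonormal_iff_ite]
  intro i j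
  have h := (Matrix.mem_orthogonalGroup_iff' (Fin n) ℝ).1 A.2
  have h2 := congrFun (congrFun h i) j
  rw [Matrix.mul_apply, Matrix.one_apply] at h2
  rw [← h2, PiLp.inner_apply]
  refine Finset.sum_congr rfl fun a _ => ?_
  simp [col, mul_comm]

theorem col_mul {n : ℕ} (A R : Matrix.orthogonalGroup (Fin n) ℝ) (i : Fin n) :
    col (A * R) i = ∑ l, (R.1 l i) • col A l := by
  ext a
  simp [col, Matrix.mul_apply, mul_comm]

theorem columns_apply {n k : ℕ} (hkn : k ≤ n) (A : Matrix.orthogonalGroup (Fin n) ℝ) (j : Fin k) :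
    columns n k A j = col A (Fin.castLE hkn j) := by
  have : (j : ℕ) < n := j.2.trans_le hkn
  simp [columns, col, this, Fin.castLE]

theorem ae_orthonormal_haarFrame {n k : ℕ} (hkn : k ≤ n) :
    ∀ᵐ V ∂haarFrame n k, Orthonormal ℝ V := by
  have hmeas : MeasurableSet {V : Fin k → E n | Orthonormal ℝ V} := by
    simp_rw [orthonormal_iff_ite, ofPred_forall]
    refine MeasurableSet.iInter fun i => MeasurableSet.iInter fun j => ?_
    exact measurableSet_eq_fun ((measurable_pi_apply i).inner (measurable_pi_apply j))
      measurable_const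
  rw [haarFrame, ae_map_iff (measurable_columns n k).aemeasurable hmeas]
  refine Filter.Eventually.of_forall fun A => ?_
  have : columns n k A = col A ∘ Fin.castLE hkn := funext fun j => columns_apply hkn A j
  rw [this]
  exact (orthonormal_col A).comp _ (Fin.castLE_injective hkn)

/-- An orthogonal matrix whose `i`-th column is a prescribed unit vector supported on the
coordinates `≥ m` and which fixes the first `m` basis vectors. -/
theorem exists_orthogonal_of_unit {n m : ℕ} (i : Fin n) (hmi : m ≤ i) (u : E n) (hu : ‖u‖ = 1)
    (hu0 : ∀ l : Fin n, (l : ℕ) < m → u l = 0) :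
    ∃ R : Matrix.orthogonalGroup (Fin n) ℝ, (∀ l, R.1 l i = u l) ∧
      ∀ j : Fin n, (j : ℕ) < m → ∀ l, R.1 l j = if l = j then 1 else 0 := by
  set e : Fin n → E n := fun j => EuclideanSpace.single j (1 : ℝ) with he
  -- The reflection that exchanges `e i` and `u` also fixes `e j` for `j < m`, since both `e i` and
  -- `u` are orthogonal to it.
  set φ : E n ≃ₗᵢ[ℝ] E n := (ℝ ∙ (e i - u))ᗮ.reflection with hφ
  have hi : φ (e i) = u := Submodule.reflection_sub (by simp [he, hu])
  have hj : ∀ j : Fin n, (j : ℕ) < m → φ (e j) = e j := by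
    intro j hjm
    refine Submodule.reflection_mem_subspace_eq_self ?_
    rw [Submodule.mem_orthogonal_singleton_iff_inner_right]
    have hne : i ≠ j := by rintro rfl; omega
    simp [he, inner_sub_left, EuclideanSpace.inner_single_right, hu0 j hjm, hne]
  have hmem : (Matrix.of fun a b => φ (e b) a) ∈ Matrix.orthogonalGroup (Fin n) ℝ := by
    rw [Matrix.mem_orthogonalGroup_iff']
    ext a b
    have h1 : inner ℝ (φ (e a)) (φ (e b)) = inner ℝ (e a) (e b) := φ.inner_map_map _ _
    have h2 : inner ℝ (e a) (e b) = if a = b then (1 : ℝ) else 0 := by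
      simp [he, EuclideanSpace.inner_single_left]
    rw [Matrix.one_apply, ← h2, ← h1, Matrix.mul_apply, PiLp.inner_apply]
    refine Finset.sum_congr rfl fun l _ => ?_
    simp [mul_comm]
  refine ⟨⟨_, hmem⟩, fun l => ?_, fun j hjm l => ?_⟩
  · simp [hi]
  · change φ (e j) l = _
    rw [hj j hjm]; simp [he]

/-! ### Subgaussian tails -/

/-- The sign `±1` attached to a Boolean. -/
def sgn (b : Bool) : ℝ := if b then 1 else -1

/-- A vector of random signs, with the first `m` coordinates replaced by zero. -/
def signVec {n : ℕ} (m : ℕ) (s : Fin n → Bool) (l : Fin n) : ℝ := if m ≤ l then sgn (s l) else 0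

/-- The sum over independent signs factors into terms `2 cosh(lam * a l)`, with `cosh t ≤
exp(t²/2)`. A masked coordinate contributes the factor `2`, so that all `2 ^ n` sign patterns are
counted whatever `m` is. -/
theorem sum_exp_signVec_le {n : ℕ} (m : ℕ) (lam : ℝ) (a : Fin n → ℝ) (ha : ∑ l, a l ^ 2 ≤ 1) :
    ∑ s : Fin n → Bool, Real.exp (lam * ∑ l, signVec m s l * a l) ≤
      2 ^ n * Real.exp (lam ^ 2 / 2) := by
  have h1 : ∀ s : Fin n → Bool, Real.exp (lam * ∑ l, signVec m s l * a l) =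
      ∏ l : Fin n, Real.exp (lam * ((if m ≤ (l : ℕ) then sgn (s l) else 0) * a l)) := by
    intro s
    rw [← Real.exp_sum, Finset.mul_sum]; rfl
  simp_rw [h1]
  rw [← Fintype.prod_sum (f := fun (l : Fin n) (b : Bool) =>
    Real.exp (lam * ((if m ≤ (l : ℕ) then sgn b else 0) * a l)))]
  have h2 : ∀ l : Fin n, ∑ b : Bool, Real.exp (lam * ((if m ≤ (l : ℕ) then sgn b else 0) * a l)) ≤
      2 * Real.exp (lam ^ 2 / 2 * a l ^ 2) := by
    intro l
    by_cases hl : m ≤ (l : ℕ)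
    · have := Real.cosh_le_exp_half_sq (lam * a l)
      rw [Real.cosh_eq] at this
      have e : (lam * a l) ^ 2 / 2 = lam ^ 2 / 2 * a l ^ 2 := by ring
      rw [e] at this
      simp only [hl, if_true, Fintype.sum_bool, sgn, one_mul, neg_mul, mul_neg, Bool.false_eq_true,
        if_false]
      linarith
    · have : (0 : ℝ) ≤ lam ^ 2 / 2 * a l ^ 2 := by positivity
      have := Real.one_le_exp this
      simp only [hl, if_false, Fintype.sum_bool, zero_mul, mul_zero, Real.exp_zero]
      linarith
  refine (Finset.prod_le_prod (fun l _ => by positivity) (fun l _ => h2 l)).trans ?_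
  rw [Finset.prod_mul_distrib, ← Real.exp_sum, ← Finset.mul_sum]
  simp only [Finset.prod_const, Finset.card_univ, Fintype.card_fin]
  gcongr
  have : 0 ≤ lam ^ 2 / 2 := by positivity
  nlinarith

theorem sum_signVec_sq {n m : ℕ} (hm : m ≤ n) (s : Fin n → Bool) :
    ∑ l, signVec m s l ^ 2 = (n : ℝ) - m := by
  have h : ∀ l : Fin n, signVec m s l ^ 2 = 1 - if (l : ℕ) < m then 1 else 0 := by
    intro l
    unfold signVec sgn
    by_cases hl : m ≤ (l : ℕ)
    · have : ¬ (l : ℕ) < m := by omega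
      simp only [hl, this, if_true, if_false]; split_ifs <;> norm_num
    · have : (l : ℕ) < m := by omega
      simp [hl, this]
  simp_rw [h]
  rw [Finset.sum_sub_distrib]
  have : (∑ l : Fin n, if (l : ℕ) < m then (1 : ℝ) else 0) = m := by
    rw [Fin.sum_univ_eq_sum_range (fun l => if l < m then (1 : ℝ) else 0) n,
      ← Finset.sum_filter]
    have : (Finset.range n).filter (· < m) = Finset.range m := by
      ext a; simp; omega
    rw [this]; simp
  rw [this]; simp

/-- Weighted exponential moment of a column against a vector that depends on the first `m` columns. -/
theorem lintegral_exp_inner_col_le {n m : ℕ} (i : Fin n) (hmi : m ≤ i)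
    (w : Matrix.orthogonalGroup (Fin n) ℝ → ℝ≥0∞) (hw : Measurable w)
    (hwd : ∀ A B, (∀ j : Fin n, (j : ℕ) < m → col A j = col B j) → w A = w B)
    (x : Matrix.orthogonalGroup (Fin n) ℝ → E n) (hx : Measurable x)
    (hxd : ∀ A B, (∀ j : Fin n, (j : ℕ) < m → col A j = col B j) → x A = x B)
    (hx1 : ∀ A, ‖x A‖ ≤ 1) (lam : ℝ) :
    ∫⁻ A, w A * ENNReal.ofReal (Real.exp (lam * Real.sqrt ((n : ℝ) - m) * inner ℝ (col A i) (x A)))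
        ∂haarOrthogonal n ≤
      ENNReal.ofReal (Real.exp (lam ^ 2 / 2)) * ∫⁻ A, w A ∂haarOrthogonal n := by
  have hmn : m < n := hmi.trans_lt i.2
  have hN : (0 : ℝ) < (n : ℝ) - m := by
    have : (m : ℝ) < n := by exact_mod_cast hmn
    linarith
  have hsq : 0 < Real.sqrt ((n : ℝ) - m) := Real.sqrt_pos.2 hN
  set I := ∫⁻ A, w A * ENNReal.ofReal
    (Real.exp (lam * Real.sqrt ((n : ℝ) - m) * inner ℝ (col A i) (x A))) ∂haarOrthogonal n with hI
  -- For each sign pattern, right translation by a suitable `R` leaves the first `m` columns, hence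
  -- `w` and `x`, alone and turns column `i` into the normalized signed sum of the columns `l ≥ m`.
  -- The integral can therefore be averaged over all patterns.
  have key : ∀ s : Fin n → Bool, I = ∫⁻ A, w A * ENNReal.ofReal
      (Real.exp (lam * ∑ l, signVec m s l * inner ℝ (col A l) (x A))) ∂haarOrthogonal n := by
    intro s
    set u : E n := WithLp.toLp 2 (fun l => signVec m s l / Real.sqrt ((n : ℝ) - m)) with hu
    have hu1 : ‖u‖ = 1 := by
      rw [EuclideanSpace.norm_eq, Real.sqrt_eq_one]
      simp only [hu, Real.norm_eq_abs, sq_abs, div_pow, Real.sq_sqrt hN.le]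
      rw [← Finset.sum_div, sum_signVec_sq hmn.le, div_self hN.ne']
    obtain ⟨R, hR1, hR2⟩ := exists_orthogonal_of_unit i hmi u hu1 (by
      intro l hl
      have : ¬ m ≤ (l : ℕ) := by omega
      simp [hu, signVec, this])
    have hcol : ∀ A, ∀ j : Fin n, (j : ℕ) < m → col (A * R) j = col A j := by
      intro A j hj
      rw [col_mul]
      simp [hR2 j hj]
    rw [hI, ← lintegral_mul_right_eq_self _ R]
    refine lintegral_congr fun A => ?_
    rw [hwd _ _ (hcol A), hxd _ _ (hcol A), col_mul, sum_inner]
    congr 3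
    rw [mul_assoc, Finset.mul_sum]
    congr 1
    refine Finset.sum_congr rfl fun l _ => ?_
    rw [hR1, real_inner_smul_left, ← mul_assoc]
    congr 1
    simp only [hu]
    field_simp
  have hcard : ∑ _s : Fin n → Bool, I = 2 ^ n * I := by
    simp
  have hmeas : ∀ l, Measurable fun A => inner ℝ (col A l) (x A) := fun l =>
    (measurable_col l).inner hx
  have hsum : (2 : ℝ≥0∞) ^ n * I ≤
      2 ^ n * (ENNReal.ofReal (Real.exp (lam ^ 2 / 2)) * ∫⁻ A, w A ∂haarOrthogonal n) := by
    rw [← hcard, Finset.sum_congr rfl fun s _ => key s, ← lintegral_finsetSum,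
      ← lintegral_const_mul _ hw, ← lintegral_const_mul _ (by fun_prop)]
    · refine lintegral_mono fun A => ?_
      rw [← Finset.mul_sum, ← ENNReal.ofReal_sum_of_nonneg fun _ _ => (Real.exp_pos _).le]
      -- Bessel's inequality supplies the bound on the coefficients of the sign sum.
      have hb : ∑ l, (inner ℝ (col A l) (x A)) ^ 2 ≤ 1 := by
        have h1 := (orthonormal_col A).sum_inner_products_le (x := x A) (s := Finset.univ)
        have h2 : ‖x A‖ ^ 2 ≤ 1 := pow_le_one₀ (norm_nonneg _) (hx1 A)
        refine le_trans (le_of_eq ?_) (h1.trans h2)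
        refine Finset.sum_congr rfl fun l _ => ?_
        simp
      have h3 := ENNReal.ofReal_le_ofReal
        (sum_exp_signVec_le m lam (fun l => inner ℝ (col A l) (x A)) hb)
      rw [ENNReal.ofReal_mul (by positivity), ENNReal.ofReal_pow (by norm_num)] at h3
      simp only [ENNReal.ofReal_ofNat] at h3
      calc _ ≤ w A * (2 ^ n * ENNReal.ofReal (Real.exp (lam ^ 2 / 2))) := by gcongr
        _ = _ := by ring
    · intro s _
      have : Measurable fun A => lam * ∑ l, signVec m s l * inner ℝ (col A l) (x A) :=
        (Finset.measurable_sum _ fun l _ => (hmeas l).const_mul _).const_mul _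
      fun_prop
  exact (ENNReal.mul_le_mul_iff_right (by simp) (by simp)).1 hsum

/-- Chernoff's bound: the exponential moment is used at the optimal parameter `t * √(n - m)`. -/
theorem lintegral_inner_col_gt_le {n m : ℕ} (i : Fin n) (hmi : m ≤ i)
    (w : Matrix.orthogonalGroup (Fin n) ℝ → ℝ≥0∞) (hw : Measurable w)
    (hwd : ∀ A B, (∀ j : Fin n, (j : ℕ) < m → col A j = col B j) → w A = w B)
    (x : Matrix.orthogonalGroup (Fin n) ℝ → E n) (hx : Measurable x)
    (hxd : ∀ A B, (∀ j : Fin n, (j : ℕ) < m → col A j = col B j) → x A = x B)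
    (hx1 : ∀ A, ‖x A‖ ≤ 1) (t : ℝ) (ht : 0 ≤ t) :
    ∫⁻ A, {A | t < inner ℝ (col A i) (x A)}.indicator w A ∂haarOrthogonal n ≤
      ENNReal.ofReal (Real.exp (-(t ^ 2 * ((n : ℝ) - m) / 2))) * ∫⁻ A, w A ∂haarOrthogonal n := by
  have hmn : m < n := hmi.trans_lt i.2
  have hN : (0 : ℝ) < (n : ℝ) - m := by
    have : (m : ℝ) < n := by exact_mod_cast hmn
    linarith
  have h := lintegral_exp_inner_col_le i hmi w hw hwd x hx hxd hx1 (t * Real.sqrt ((n : ℝ) - m))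
  have hc : t * Real.sqrt ((n : ℝ) - m) * Real.sqrt ((n : ℝ) - m) = t * ((n : ℝ) - m) := by
    rw [mul_assoc, Real.mul_self_sqrt hN.le]
  have hc2 : (t * Real.sqrt ((n : ℝ) - m)) ^ 2 = t ^ 2 * ((n : ℝ) - m) := by
    rw [mul_pow, Real.sq_sqrt hN.le]
  rw [hc, hc2] at h
  calc _ ≤ ∫⁻ A, ENNReal.ofReal (Real.exp (-(t ^ 2 * ((n : ℝ) - m)))) * (w A * ENNReal.ofReal
        (Real.exp (t * ((n : ℝ) - m) * inner ℝ (col A i) (x A)))) ∂haarOrthogonal n := by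
        refine lintegral_mono fun A => ?_
        by_cases hA : t < inner ℝ (col A i) (x A)
        · rw [indicator_of_mem (by exact hA), mul_left_comm,
            ← ENNReal.ofReal_mul (Real.exp_pos _).le, ← Real.exp_add]
          refine le_mul_of_one_le_right (zero_le) ?_
          rw [ENNReal.one_le_ofReal]
          refine Real.one_le_exp ?_
          have : t * ((n : ℝ) - m) * t ≤ t * ((n : ℝ) - m) * inner ℝ (col A i) (x A) :=
            mul_le_mul_of_nonneg_left hA.le (by positivity)
          nlinarith
        · rw [indicator_of_notMem (by exact hA)]; exact zero_le
    _ ≤ ENNReal.ofReal (Real.exp (-(t ^ 2 * ((n : ℝ) - m)))) *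
          (ENNReal.ofReal (Real.exp (t ^ 2 * ((n : ℝ) - m) / 2)) * ∫⁻ A, w A ∂haarOrthogonal n) := by
        rw [lintegral_const_mul']
        · gcongr
        · exact ENNReal.ofReal_ne_top
    _ = _ := by
        rw [← mul_assoc, ← ENNReal.ofReal_mul (Real.exp_pos _).le, ← Real.exp_add]
        congr 4; ring

/-- Weighted tail bound for a vector of a Haar random frame against a vector of norm at most one
that depends only on earlier vectors of the frame. -/
theorem lintegral_indicator_inner_le {n k m : ℕ} (hkn : k ≤ n) (i : Fin k) (hmi : m ≤ i)
    (w : (Fin k → E n) → ℝ≥0∞) (hw : Measurable w) (hwd : DependsOn w {j | (j : ℕ) < m})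
    (x : (Fin k → E n) → E n) (hx : Measurable x) (hxd : DependsOn x {j | (j : ℕ) < m})
    (hx1 : ∀ V, ‖x V‖ ≤ 1) (t : ℝ) (ht : 0 ≤ t) :
    ∫⁻ V, {V | t < |inner ℝ (V i) (x V)|}.indicator w V ∂haarFrame n k ≤
      2 * ENNReal.ofReal (Real.exp (-(t ^ 2 * ((n : ℝ) - m) / 2))) *
        ∫⁻ V, w V ∂haarFrame n k := by
  have hdep : ∀ {β : Type} (f : (Fin k → E n) → β), DependsOn f {j | (j : ℕ) < m} →
      ∀ A B, (∀ j : Fin n, (j : ℕ) < m → col A j = col B j) →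
        f (columns n k A) = f (columns n k B) := by
    intro β f hf A B hAB
    refine hf fun j hj => ?_
    rw [columns_apply hkn, columns_apply hkn]
    exact hAB _ hj
  have hc := measurable_columns n k
  have hin : Measurable fun V : Fin k → E n => inner ℝ (V i) (x V) :=
    (measurable_pi_apply i).inner hx
  rw [haarFrame, lintegral_map hw hc, lintegral_map]
  rotate_left
  · exact hw.indicator (measurableSet_lt measurable_const
      (continuous_abs.measurable.comp hin))
  · exact hc
  have h1 := lintegral_inner_col_gt_le (Fin.castLE hkn i) hmi _ (hw.comp hc) (hdep w hwd)
    _ (hx.comp hc) (hdep x hxd) (fun A => hx1 _) t ht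
  have h2 := lintegral_inner_col_gt_le (Fin.castLE hkn i) hmi _ (hw.comp hc) (hdep w hwd)
    (fun A => - x (columns n k A)) (hx.comp hc).neg
    (fun A B h => by rw [hdep x hxd A B h]) (fun A => by rw [norm_neg]; exact hx1 _) t ht
  rw [mul_assoc, two_mul]
  refine le_trans ?_ (add_le_add h1 h2)
  rw [← lintegral_add_left]
  · refine lintegral_mono fun A => ?_
    simp only [indicator, mem_ofPred_eq, columns_apply hkn, Function.comp, inner_neg_right]
    by_cases hA : t < |inner ℝ (col A (Fin.castLE hkn i)) (x (columns n k A))|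
    · rw [if_pos hA]
      rcases lt_abs.1 hA with h | h
      · rw [if_pos h]; exact le_self_add
      · rw [if_pos h]; exact le_add_self
    · rw [if_neg hA]; exact zero_le
  · exact (hw.comp hc).indicator (measurableSet_lt measurable_const
      ((measurable_col _).inner (hx.comp hc)))

/-! ### Ball averages of vector valued functions -/

/-- The uniform probability measure on the ball of radius `η` around the origin. -/
def unifBall (n : ℕ) (η : ℝ) : Measure (E n) :=
  (volume (Metric.closedBall (0 : E n) η))⁻¹ • volume.restrict (Metric.closedBall 0 η)

/-- The average of `f` over the ball of radius `η` around `x`. -/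
def ballAvg {n : ℕ} {F : Type*} [NormedAddCommGroup F] [NormedSpace ℝ F] (η : ℝ) (f : E n → F)
    (x : E n) : F :=
  ∫ u, f (x + u) ∂unifBall n η

theorem volume_closedBall_pos {n : ℕ} {η : ℝ} (hη : 0 < η) :
    0 < volume (Metric.closedBall (0 : E n) η) :=
  Metric.measure_closedBall_pos _ _ hη

theorem isProbabilityMeasure_unifBall (n : ℕ) {η : ℝ} (hη : 0 < η) :
    IsProbabilityMeasure (unifBall n η) := by
  constructor
  rw [unifBall, Measure.smul_apply, Measure.restrict_apply_univ, smul_eq_mul]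
  exact ENNReal.inv_mul_cancel (volume_closedBall_pos hη).ne' measure_closedBall_lt_top.ne

theorem unifBall_absolutelyContinuous (n : ℕ) (η : ℝ) : unifBall n η ≪ volume :=
  (Measure.smul_absolutelyContinuous).trans Measure.absolutelyContinuous_restrict

theorem ae_unifBall_norm_le (n : ℕ) (η : ℝ) : ∀ᵐ u ∂unifBall n η, ‖u‖ ≤ η := by
  refine Measure.smul_absolutelyContinuous.ae_le ?_
  filter_upwards [ae_restrict_mem Metric.isClosed_closedBall.measurableSet] with u hu
  simpa using hu

theorem integrable_comp_add_of_lipschitz {n : ℕ} {F : Type*} [NormedAddCommGroup F] {η : ℝ}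
    (hη : 0 < η) {C : NNReal} {f : E n → F}
    (hf : LipschitzWith C f) (x : E n) : Integrable (fun u => f (x + u)) (unifBall n η) := by
  have := isProbabilityMeasure_unifBall n hη
  have hc : Continuous fun u => f (x + u) := hf.continuous.comp (continuous_const_add x)
  refine Integrable.of_bound hc.aestronglyMeasurable (‖f x‖ + C * η) ?_
  filter_upwards [ae_unifBall_norm_le n η] with u hu
  have h := hf.norm_sub_le (x + u) x
  rw [add_sub_cancel_left] at h
  have h2 : (C : ℝ) * ‖u‖ ≤ C * η := by gcongr
  calc ‖f (x + u)‖ = ‖f x + (f (x + u) - f x)‖ := by rw [add_sub_cancel]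
    _ ≤ _ := (norm_add_le _ _).trans (by linarith)

section

variable {n : ℕ} {F : Type*} [NormedAddCommGroup F] [NormedSpace ℝ F]

theorem ballAvg_eq_setIntegral (η : ℝ) (f : E n → F) (x : E n) :
    ballAvg η f x = (volume.real (Metric.closedBall (0 : E n) η))⁻¹ •
      ∫ y in Metric.closedBall x η, f y := by
  have h := (measurePreserving_add_left (volume : Measure (E n)) x).setIntegral_preimage_emb
    (measurableEmbedding_addLeft x) f (Metric.closedBall x η)
  rw [← h, ballAvg, unifBall, integral_smul_measure, ENNReal.toReal_inv]
  simp [measureReal_def]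

/-- Centring the ball at the origin moves the base point into the integrand, where one can
differentiate under the integral. -/
theorem ballSmooth_eq_ballAvg (η : ℝ) (f : E n → ℝ) : ballSmooth η f = ballAvg η f := by
  ext x
  rw [ballSmooth, setAverage_eq, ballAvg_eq_setIntegral, measureReal_def, measureReal_def,
    Measure.addHaar_closedBall_center]

theorem lipschitzWith_ballAvg {η : ℝ} (hη : 0 < η) {C : NNReal} {f : E n → F}
    (hf : LipschitzWith C f) : LipschitzWith C (ballAvg η f) := by
  have := isProbabilityMeasure_unifBall n hη
  refine LipschitzWith.of_dist_le_mul fun x y => ?_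
  rw [dist_eq_norm, ballAvg, ballAvg, ← integral_sub (integrable_comp_add_of_lipschitz hη hf x)
    (integrable_comp_add_of_lipschitz hη hf y)]
  have h := norm_integral_le_of_norm_le_const (μ := unifBall n η) (C := C * dist x y)
    (f := fun u => f (x + u) - f (y + u)) (Filter.Eventually.of_forall fun u => by
      simpa [dist_eq_norm] using hf.norm_sub_le (x + u) (y + u))
  simpa using h

theorem norm_ballAvg_sub_le [CompleteSpace F] {η : ℝ} (hη : 0 < η) {C : NNReal} {f : E n → F}
    (hf : LipschitzWith C f) (x : E n) : ‖ballAvg η f x - f x‖ ≤ C * η := by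
  have := isProbabilityMeasure_unifBall n hη
  have h1 : ballAvg η f x - f x = ∫ u, (f (x + u) - f x) ∂unifBall n η := by
    rw [integral_sub (integrable_comp_add_of_lipschitz hη hf x) (integrable_const _)]
    simp [ballAvg]
  have h := norm_integral_le_of_norm_le_const (μ := unifBall n η) (C := C * η)
    (f := fun u => f (x + u) - f x) (by
      filter_upwards [ae_unifBall_norm_le n η] with u hu
      have h := hf.norm_sub_le (x + u) x
      rw [add_sub_cancel_left] at h
      exact h.trans (by gcongr))
  rw [h1]
  simpa using h

theorem ballAvg_congr {η : ℝ} {f f' : E n → F} {x : E n}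
    (h : ∀ y ∈ Metric.closedBall x η, f y = f' y) : ballAvg η f x = ballAvg η f' x := by
  refine integral_congr_ae ?_
  filter_upwards [ae_unifBall_norm_le n η] with u hu
  exact h _ (by simpa using hu)

/-- For `d = dist x y ≤ η` the ball of radius `η - d` around `x` lies in the ball around `y`. What
remains is a shell of relative volume `1 - (1 - d/η)^n`, at most `n * d/η` by Bernoulli. For `d > η`
the bound is trivial, apart from `n = 0`, where the two points are equal. -/
theorem measureReal_closedBall_diff_le (x y : E n) {η : ℝ} (hη : 0 < η) :
    volume.real (Metric.closedBall x η \ Metric.closedBall y η) ≤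
      n * (dist x y / η) * volume.real (Metric.closedBall (0 : E n) η) := by
  set d := dist x y
  have hd : 0 ≤ d := dist_nonneg
  have hv : 0 ≤ volume.real (Metric.closedBall (0 : E n) η) := measureReal_nonneg
  rcases le_or_gt d η with hdη | hdη
  · have hsub : Metric.closedBall x (η - d) ⊆ Metric.closedBall x η :=
      Metric.closedBall_subset_closedBall (by linarith)
    have h1 : Metric.closedBall x η \ Metric.closedBall y η ⊆
        Metric.closedBall x η \ Metric.closedBall x (η - d) := by
      refine sdiff_subset_sdiff_right fun z hz => ?_
      rw [Metric.mem_closedBall] at hz ⊢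
      linarith [dist_triangle z x y]
    have h2 := measureReal_mono (μ := volume) h1
      ((measure_mono sdiff_subset).trans_lt measure_closedBall_lt_top).ne
    rw [measureReal_sdiff hsub Metric.isClosed_closedBall.measurableSet
      measure_closedBall_lt_top.ne] at h2
    rw [Measure.addHaar_real_closedBall' _ x hη.le,
      Measure.addHaar_real_closedBall' _ x (by linarith : 0 ≤ η - d)] at h2
    rw [Measure.addHaar_real_closedBall' _ _ hη.le]
    refine h2.trans ?_
    simp only [finrank_euclideanSpace, Fintype.card_fin]
    set c := volume.real (Metric.closedBall (0 : E n) 1)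
    have hc : 0 ≤ c := measureReal_nonneg
    have hb := one_add_mul_le_pow (a := - (d / η)) (by
      have : d / η ≤ 1 := (div_le_one hη).2 hdη
      linarith) n
    have he : (η - d) ^ n = η ^ n * (1 + - (d / η)) ^ n := by
      rw [← mul_pow]; congr 1; field_simp; ring
    rw [he]
    have := mul_le_mul_of_nonneg_left hb (by positivity : 0 ≤ η ^ n)
    nlinarith [mul_le_mul_of_nonneg_right this hc]
  · rcases Nat.eq_zero_or_pos n with rfl | hn
    · have : x = y := Subsingleton.elim _ _
      simp [this]
    · have h1 : volume.real (Metric.closedBall x η \ Metric.closedBall y η) ≤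
          volume.real (Metric.closedBall (0 : E n) η) := by
        have := measureReal_mono (μ := volume)
          (sdiff_subset (s := Metric.closedBall x η) (t := Metric.closedBall y η))
          measure_closedBall_lt_top.ne
        rwa [measureReal_def, measureReal_def, Measure.addHaar_closedBall_center] at this
      refine h1.trans (le_mul_of_one_le_left hv ?_)
      have : (1 : ℝ) ≤ n := by exact_mod_cast hn
      have : 1 ≤ d / η := (one_le_div hη).2 hdη.le
      nlinarith

/-- Averaging a bounded function over balls yields a Lipschitz function. -/
theorem exists_lipschitzWith_ballAvg {η : ℝ} (hη : 0 < η) {M : ℝ} {f : E n → F}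
    (hf : AEStronglyMeasurable f volume) (hM : ∀ x, ‖f x‖ ≤ M) :
    ∃ C, LipschitzWith C (ballAvg η f) := by
  have hM0 : 0 ≤ M := (norm_nonneg _).trans (hM 0)
  have hvol : 0 < volume.real (Metric.closedBall (0 : E n) η) :=
    ENNReal.toReal_pos (volume_closedBall_pos hη).ne' measure_closedBall_lt_top.ne
  refine ⟨(M * (n / η) * 2).toNNReal, LipschitzWith.of_dist_le_mul fun x y => ?_⟩
  rw [Real.coe_toNNReal _ (by positivity), dist_eq_norm, ballAvg_eq_setIntegral,
    ballAvg_eq_setIntegral, ← smul_sub, norm_smul, norm_inv, Real.norm_of_nonneg hvol.le]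
  have hint : ∀ z : E n, IntegrableOn f (Metric.closedBall z η) := fun z =>
    Measure.integrableOn_of_bounded measure_closedBall_lt_top.ne hf
      (Filter.Eventually.of_forall hM)
  have hB : ∀ z w : E n, ‖∫ y in Metric.closedBall z η \ Metric.closedBall w η, f y‖ ≤
      M * (n * (dist z w / η) * volume.real (Metric.closedBall (0 : E n) η)) := fun z w =>
    (norm_setIntegral_le_of_norm_le_const
      ((measure_mono sdiff_subset).trans_lt measure_closedBall_lt_top) fun y _ => hM y).trans
      (mul_le_mul_of_nonneg_left (measureReal_closedBall_diff_le z w hη) hM0)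
  have e1 := integral_inter_add_sdiff (t := Metric.closedBall y η)
    Metric.isClosed_closedBall.measurableSet (hint x)
  have e2 := integral_inter_add_sdiff (t := Metric.closedBall x η)
    Metric.isClosed_closedBall.measurableSet (hint y)
  rw [← e1, ← e2, inter_comm (Metric.closedBall y η), add_sub_add_left_eq_sub,
    inv_mul_le_iff₀ hvol]
  refine (norm_sub_le _ _).trans ((add_le_add (hB x y) (hB y x)).trans (le_of_eq ?_))
  rw [dist_comm y x]
  ring

variable [FiniteDimensional ℝ F]

/-- By Rademacher's theorem `f` is differentiable almost everywhere, and the Lipschitz constant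
dominates the difference quotients. So the average is differentiable everywhere, even where `f` is
not. -/
theorem hasFDerivAt_ballAvg {η : ℝ} (hη : 0 < η) {C : NNReal} {f : E n → F}
    (hf : LipschitzWith C f) (x : E n) :
    HasFDerivAt (ballAvg η f) (ballAvg η (fderiv ℝ f) x) x := by
  have := isProbabilityMeasure_unifBall n hη
  have := FiniteDimensional.complete ℝ F
  have hm : Measurable fun u => fderiv ℝ f (x + u) :=
    (measurable_fderiv ℝ f).comp (measurable_const_add x)
  have hae : ∀ᵐ u ∂(volume : Measure (E n)), DifferentiableAt ℝ f (x + u) :=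
    (measurePreserving_add_left volume x).quasiMeasurePreserving.ae hf.ae_differentiableAt
  refine (hasFDerivAt_integral_of_dominated_loc_of_lip (bound := fun _ => (C : ℝ))
    (F := fun y u => f (y + u)) (s := Set.univ) Filter.univ_mem
    (Filter.Eventually.of_forall fun y =>
      (integrable_comp_add_of_lipschitz hη hf y).aestronglyMeasurable)
    (integrable_comp_add_of_lipschitz hη hf x) ?_ ?_ (integrable_const _) ?_).2
  · exact hm.aestronglyMeasurable
  · refine Filter.Eventually.of_forall fun u => ?_
    rw [lipschitzOnWith_univ]
    refine LipschitzWith.of_dist_le_mul fun y z => ?_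
    simpa using hf.dist_le_mul (y + u) (z + u)
  · filter_upwards [(unifBall_absolutelyContinuous n η).ae_le hae] with u hu
    simpa using (hasFDerivAt_comp_add_right (f := f) (f' := fderiv ℝ f (x + u)) u).2 hu.hasFDerivAt

end

/-- `f` is `m` times differentiable, with Lipschitz derivatives up to the order `m`. -/
def LipDiff {n : ℕ} : ℕ → (F : Type) → [NormedAddCommGroup F] → [NormedSpace ℝ F] →
    (E n → F) → Prop
  | 0, _, _, _, f => ∃ C, LipschitzWith C f
  | m + 1, F, _, _, f => (∃ C, LipschitzWith C f) ∧ Differentiable ℝ f ∧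
      LipDiff m (E n →L[ℝ] F) (fderiv ℝ f)

/-- Averaging commutes with differentiation, which reduces the claim to `m = 0`. There the
derivative of `f` is only bounded and measurable, but its average is Lipschitz: one order is gained.
-/
theorem LipDiff.ballAvg {n : ℕ} {η : ℝ} (hη : 0 < η) (m : ℕ) :
    ∀ (F : Type) [NormedAddCommGroup F] [NormedSpace ℝ F] [FiniteDimensional ℝ F] (f : E n → F),
      LipDiff m F f → LipDiff (m + 1) F (ballAvg η f) := by
  induction m with
  | zero =>
    rintro F _ _ _ f ⟨C, hf⟩
    have := FiniteDimensional.complete ℝ F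
    have hd := fun x => hasFDerivAt_ballAvg hη hf x
    refine ⟨⟨C, lipschitzWith_ballAvg hη hf⟩, fun x => (hd x).differentiableAt, ?_⟩
    have e : fderiv ℝ (SmoothLB.ballAvg η f) = SmoothLB.ballAvg η (fderiv ℝ f) :=
      funext fun x => (hd x).fderiv
    rw [e]
    exact exists_lipschitzWith_ballAvg hη (measurable_fderiv ℝ f).aestronglyMeasurable
      fun x => norm_fderiv_le_of_lipschitz ℝ hf
  | succ m ih =>
    rintro F _ _ _ f ⟨⟨C, hf⟩, _, h⟩
    have hd := fun x => hasFDerivAt_ballAvg hη hf x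
    refine ⟨⟨C, lipschitzWith_ballAvg hη hf⟩, fun x => (hd x).differentiableAt, ?_⟩
    have e : fderiv ℝ (SmoothLB.ballAvg η f) = SmoothLB.ballAvg η (fderiv ℝ f) :=
      funext fun x => (hd x).fderiv
    rw [e]
    exact ih _ _ h

theorem LipDiff.contDiff {n : ℕ} (m : ℕ) :
    ∀ (F : Type) [NormedAddCommGroup F] [NormedSpace ℝ F] (f : E n → F),
      LipDiff m F f → ContDiff ℝ m f := by
  induction m with
  | zero => rintro F _ _ f ⟨C, hf⟩; exact contDiff_zero.2 hf.continuous
  | succ m ih =>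
    rintro F _ _ f ⟨_, hd, h⟩
    rw [Nat.cast_succ, contDiff_succ_iff_fderiv]
    exact ⟨hd, by simp, ih _ _ h⟩

/-! ### The iterated smoothing -/

theorem lipDiff_smoothing {n : ℕ} {β : ℝ} (hβ : 0 < β) {C : NNReal} {f : E n → ℝ}
    (hf : LipschitzWith C f) (p : ℕ) : LipDiff p ℝ (smoothing β p f) := by
  induction p with
  | zero => exact ⟨C, hf⟩
  | succ p ih =>
    rw [smoothing, ballSmooth_eq_ballAvg]
    exact LipDiff.ballAvg (by positivity) p ℝ _ ih

theorem contDiff_smoothing {n : ℕ} {β : ℝ} (hβ : 0 < β) {C : NNReal} {f : E n → ℝ}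
    (hf : LipschitzWith C f) (p : ℕ) : ContDiff ℝ p (smoothing β p f) :=
  LipDiff.contDiff p ℝ _ (lipDiff_smoothing hβ hf p)

theorem lipschitzWith_smoothing {n : ℕ} {β : ℝ} (hβ : 0 < β) {C : NNReal} {f : E n → ℝ}
    (hf : LipschitzWith C f) (p : ℕ) : LipschitzWith C (smoothing β p f) := by
  induction p with
  | zero => exact hf
  | succ p ih =>
    rw [smoothing, ballSmooth_eq_ballAvg]
    exact lipschitzWith_ballAvg (by positivity) ih

theorem abs_smoothing_sub_le {n : ℕ} {β : ℝ} (hβ : 0 < β) {f : E n → ℝ}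
    (hf : LipschitzWith 1 f) (p : ℕ) (x : E n) :
    |smoothing β p f x - f x| ≤ β * (1 - 1 / 2 ^ p) := by
  induction p with
  | zero => simp [smoothing]
  | succ p ih =>
    rw [smoothing, ballSmooth_eq_ballAvg]
    have h := norm_ballAvg_sub_le (by positivity : 0 < β / 2 ^ (p + 1))
      (lipschitzWith_smoothing hβ hf p) x
    rw [Real.norm_eq_abs] at h
    refine (abs_sub_le _ (smoothing β p f x) _).trans ((add_le_add h ih).trans (le_of_eq ?_))
    simp only [NNReal.coe_one]
    field_simp
    ring

/-- The radii `β/2, …, β/2^p` add up to `β(1 - 1/2^p)`. The radius `R` varies within the induction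
because each averaging enlarges the region that must be controlled. -/
theorem smoothing_congr {n : ℕ} {β : ℝ} {f f' : E n → ℝ} {x : E n} (p : ℕ) :
    ∀ {R : ℝ}, (∀ y ∈ Metric.ball x (R + β * (1 - 1 / 2 ^ p)), f y = f' y) →
      ∀ y ∈ Metric.ball x R, smoothing β p f y = smoothing β p f' y := by
  induction p with
  | zero => intro R h y hy; exact h y (by simpa using hy)
  | succ p ih =>
    intro R h y hy
    rw [smoothing, smoothing, ballSmooth_eq_ballAvg, ballSmooth_eq_ballAvg]
    refine ballAvg_congr fun z hz => ?_
    refine ih (R := R + β / 2 ^ (p + 1)) (fun w hw => h w ?_) z ?_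
    · convert! hw using 2
      field_simp
      ring
    · rw [Metric.mem_ball] at hy ⊢
      rw [Metric.mem_closedBall] at hz
      linarith [dist_triangle z y x]

/-- The radii leave a margin `β/2^p`, so the smoothed functions agree on a neighbourhood of `x` and
therefore have the same derivatives there. -/
theorem oracle_smoothing_congr {n : ℕ} {β : ℝ} (hβ : 0 < β) {f f' : E n → ℝ} (p : ℕ) (x : Ball n)
    (h : ∀ y ∈ Metric.ball (x : E n) β, f y = f' y) :
    oracle p (smoothing β p f) x = oracle p (smoothing β p f') x := by
  have h2 := smoothing_congr (x := (x : E n)) (f := f) (f' := f') p (R := β / 2 ^ p) (by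
    intro y hy
    rw [show β / 2 ^ p + β * (1 - 1 / 2 ^ p) = β by ring] at hy
    exact h y hy)
  have he : smoothing β p f =ᶠ[nhds (x : E n)] smoothing β p f' :=
    Filter.eventually_of_mem (Metric.ball_mem_nhds _ (by positivity)) h2
  funext i s
  simp only [oracle]
  rw [(he.iteratedFDeriv ℝ (i : ℕ)).eq_of_nhds]

/-! ### Measurability in a parameter -/

theorem measurable_ballAvg_param {n : ℕ} {X : Type*} [MeasurableSpace X] {η : ℝ} (hη : 0 < η)
    {f : X → E n → ℝ} (hf : Measurable (Function.uncurry f)) :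
    Measurable (Function.uncurry fun a => ballAvg η (f a)) := by
  have := isProbabilityMeasure_unifBall n hη
  have h : StronglyMeasurable fun q : (X × E n) × E n => f q.1.1 (q.1.2 + q.2) := by
    refine Measurable.stronglyMeasurable ?_
    exact hf.comp (by fun_prop : Measurable fun q : (X × E n) × E n => (q.1.1, q.1.2 + q.2))
  exact (h.integral_prod_right' (ν := unifBall n η)).measurable

theorem measurable_smoothing_param {n : ℕ} {X : Type*} [MeasurableSpace X] {β : ℝ} (hβ : 0 < β)
    {f : X → E n → ℝ} (hf : Measurable (Function.uncurry f)) (p : ℕ) :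
    Measurable (Function.uncurry fun a => smoothing β p (f a)) := by
  induction p with
  | zero => exact hf
  | succ p ih =>
    simp only [smoothing, ballSmooth_eq_ballAvg]
    exact measurable_ballAvg_param (by positivity) ih

/-- Each derivative is a pointwise limit of difference quotients of the preceding one, with step
`1/j`. This gives joint measurability in the parameter and the point, which adaptive queries
require. -/
theorem measurable_iteratedFDeriv_param {n : ℕ} {X : Type*} [MeasurableSpace X]
    {f : X → E n → ℝ} (hf : Measurable (Function.uncurry f)) {p : ℕ}
    (hp : ∀ a, ContDiff ℝ p (f a)) (i : ℕ) (hi : i ≤ p) :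
    ∀ m : Fin i → E n, Measurable fun q : X × E n => iteratedFDeriv ℝ i (f q.1) q.2 m := by
  induction i with
  | zero =>
    intro m
    simp only [iteratedFDeriv_zero_apply]
    exact hf
  | succ i ih =>
    intro m
    have ihm := ih (by omega) (Fin.tail m)
    refine measurable_of_tendsto_metrizable (f := fun (j : ℕ) (q : X × E n) =>
      (j : ℝ) • (iteratedFDeriv ℝ i (f q.1) (q.2 + (j : ℝ)⁻¹ • m 0) (Fin.tail m) -
        iteratedFDeriv ℝ i (f q.1) q.2 (Fin.tail m))) (fun j => ?_) ?_
    · have hq : Measurable fun q : X × E n => (q.1, q.2 + (j : ℝ)⁻¹ • m 0) := by fun_prop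
      exact ((ihm.comp hq).sub ihm).const_smul (j : ℝ)
    · rw [tendsto_pi_nhds]
      intro q
      have hd : DifferentiableAt ℝ (iteratedFDeriv ℝ i (f q.1)) q.2 :=
        (hp q.1).differentiable_iteratedFDeriv (by exact_mod_cast hi) q.2
      have h := (hd.hasFDerivAt.continuousMultilinear_apply_const (Fin.tail m)).lim (m 0)
        (c := fun j : ℕ => (j : ℝ)) (l := Filter.atTop)
        (by simpa using tendsto_natCast_atTop_atTop)
      rw [iteratedFDeriv_succ_apply_left]
      simpa using h

/-! ### The softmax -/

section Softmax

variable {k : ℕ} {ρ : ℝ}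

theorem sum_exp_Iic_pos (i : Fin k) (z : Fin k → ℝ) :
    0 < ∑ j ∈ Finset.Iic i, Real.exp (z j / ρ) :=
  Finset.sum_pos (fun _ _ => Real.exp_pos _) ⟨i, Finset.mem_Iic.2 le_rfl⟩

theorem le_smaxLE (hρ : 0 < ρ) {i j : Fin k} (hj : j ≤ i) (z : Fin k → ℝ) :
    z j ≤ smaxLE ρ i z := by
  have h : Real.exp (z j / ρ) ≤ ∑ j ∈ Finset.Iic i, Real.exp (z j / ρ) :=
    Finset.single_le_sum (f := fun j => Real.exp (z j / ρ)) (fun _ _ => (Real.exp_pos _).le)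
      (Finset.mem_Iic.2 hj)
  have h2 := (Real.le_log_iff_exp_le (sum_exp_Iic_pos i z)).2 h
  calc z j = ρ * (z j / ρ) := by field_simp
    _ ≤ _ := by unfold smaxLE; gcongr

/-- Adding `d` to every coordinate multiplies the sum of exponentials by `exp(d/ρ)`. Both the
Lipschitz bound and the upper bound on the softmax come from this. -/
theorem smaxLE_le_add (hρ : 0 < ρ) {i : Fin k} {z z' : Fin k → ℝ} {d : ℝ}
    (h : ∀ j ≤ i, z j ≤ z' j + d) : smaxLE ρ i z ≤ smaxLE ρ i z' + d := by
  have h1 : ∑ j ∈ Finset.Iic i, Real.exp (z j / ρ) ≤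
      Real.exp (d / ρ) * ∑ j ∈ Finset.Iic i, Real.exp (z' j / ρ) := by
    rw [Finset.mul_sum]
    refine Finset.sum_le_sum fun j hj => ?_
    rw [← Real.exp_add, ← add_div]
    have := h j (Finset.mem_Iic.1 hj)
    gcongr
    linarith
  have h2 := Real.log_le_log (sum_exp_Iic_pos i z) h1
  rw [Real.log_mul (Real.exp_pos _).ne' (sum_exp_Iic_pos i z').ne', Real.log_exp] at h2
  have h3 := mul_le_mul_of_nonneg_left h2 hρ.le
  have : ρ * (d / ρ) = d := by field_simp
  unfold smaxLE
  linarith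

theorem smaxLE_le (hρ : 0 < ρ) {i : Fin k} {z : Fin k → ℝ} {M : ℝ} (h : ∀ j ≤ i, z j ≤ M) :
    smaxLE ρ i z ≤ M + ρ * Real.log k := by
  have h1 : smaxLE ρ i z ≤ smaxLE ρ i (fun _ => 0) + M :=
    smaxLE_le_add hρ fun j hj => by simpa using h j hj
  have h2 : smaxLE ρ i (fun _ => 0) ≤ ρ * Real.log k := by
    unfold smaxLE
    have hk : ((Finset.Iic i).card : ℝ) ≤ k := by
      have := Finset.card_le_univ (Finset.Iic i)
      rw [Fintype.card_fin] at this
      exact_mod_cast this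
    have hp : (0 : ℝ) < (Finset.Iic i).card := by
      exact_mod_cast Finset.card_pos.2 ⟨i, Finset.mem_Iic.2 le_rfl⟩
    simp only [zero_div, Real.exp_zero, Finset.sum_const, nsmul_eq_mul, mul_one]
    gcongr
  linarith

theorem smaxLE_congr {i : Fin k} {z z' : Fin k → ℝ} (h : ∀ j ≤ i, z j = z' j) :
    smaxLE ρ i z = smaxLE ρ i z' := by
  unfold smaxLE
  congr 2
  exact Finset.sum_congr rfl fun j hj => by rw [h j (Finset.mem_Iic.1 hj)]

/-- Appending coordinates that are much smaller than an earlier one hardly changes the softmax. -/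
theorem smaxLE_le_add_mul (hρ : 0 < ρ) {m i : Fin k} (hmi : m ≤ i) {z : Fin k → ℝ} {δ : ℝ}
    (hδ : 0 ≤ δ) (h : ∀ l, m < l → l ≤ i → Real.exp ((z l - z m) / ρ) ≤ δ) :
    smaxLE ρ i z ≤ smaxLE ρ m z + ρ * (((i : ℝ) - m) * δ) := by
  set Sm := ∑ j ∈ Finset.Iic m, Real.exp (z j / ρ) with hSm
  have hpos : 0 < Sm := sum_exp_Iic_pos m z
  have hmem : Real.exp (z m / ρ) ≤ Sm :=
    Finset.single_le_sum (f := fun j => Real.exp (z j / ρ)) (fun _ _ => (Real.exp_pos _).le)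
      (Finset.mem_Iic.2 le_rfl)
  have hsplit : Finset.Iic i = Finset.Iic m ∪ Finset.Ioc m i := by
    ext a; simp only [Finset.mem_Iic, Finset.mem_union, Finset.mem_Ioc]
    constructor
    · intro ha
      rcases le_or_gt a m with h | h
      · exact Or.inl h
      · exact Or.inr ⟨h, ha⟩
    · rintro (h | h)
      · exact h.trans hmi
      · exact h.2
  have hdisj : Disjoint (Finset.Iic m) (Finset.Ioc m i) := by
    rw [Finset.disjoint_left]
    intro a ha hb
    exact absurd (Finset.mem_Iic.1 ha) (not_le.2 (Finset.mem_Ioc.1 hb).1)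
  have hS : ∑ j ∈ Finset.Iic i, Real.exp (z j / ρ) ≤ Sm * (1 + ((i : ℝ) - m) * δ) := by
    rw [hsplit, Finset.sum_union hdisj, mul_add, mul_one]
    gcongr
    have : ∀ l ∈ Finset.Ioc m i, Real.exp (z l / ρ) ≤ Sm * δ := by
      intro l hl
      have hl' := Finset.mem_Ioc.1 hl
      have e : Real.exp (z l / ρ) = Real.exp (z m / ρ) * Real.exp ((z l - z m) / ρ) := by
        rw [← Real.exp_add]; congr 1; ring
      rw [e]
      exact mul_le_mul hmem (h l hl'.1 hl'.2) (Real.exp_pos _).le hpos.le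
    refine (Finset.sum_le_sum this).trans (le_of_eq ?_)
    rw [Finset.sum_const, Fin.card_Ioc, nsmul_eq_mul, Nat.cast_sub (by exact_mod_cast hmi)]
    ring
  have hd : 0 ≤ ((i : ℝ) - m) * δ := by
    have : (m : ℝ) ≤ i := by exact_mod_cast hmi
    exact mul_nonneg (by linarith) hδ
  have h2 := Real.log_le_log (sum_exp_Iic_pos i z) hS
  rw [Real.log_mul hpos.ne' (by positivity)] at h2
  have h3 := Real.log_le_sub_one_of_pos (by positivity : 0 < 1 + ((i : ℝ) - m) * δ)
  have h4 : Real.log (∑ j ∈ Finset.Iic i, Real.exp (z j / ρ)) ≤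
      Real.log Sm + ((i : ℝ) - m) * δ := by linarith
  calc smaxLE ρ i z ≤ ρ * (Real.log Sm + ((i : ℝ) - m) * δ) := by unfold smaxLE; gcongr
    _ = _ := by unfold smaxLE; ring

end Softmax

/-! ### The maximum of the pieces -/

section HMax

variable {n k : ℕ} {γ ρ α : ℝ}

theorem fPiece_le_hMax (V : Fin k → E n) (i : Fin k) (x : E n) :
    fPiece γ ρ α V i x ≤ hMax γ ρ α V x :=
  le_ciSup (f := fun i => fPiece γ ρ α V i x) (finite_range _).bddAbove i

theorem lipschitzWith_hMax (hρ : 0 < ρ) {L : NNReal} {V : Fin k → E n} (hV : ∀ j, ‖V j‖ ≤ L) :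
    LipschitzWith L (hMax γ ρ α V) := by
  refine LipschitzWith.of_le_add_mul L fun x y => ?_
  rcases isEmpty_or_nonempty (Fin k) with hk | hk
  · simp only [hMax, Real.iSup_of_isEmpty]; positivity
  · refine ciSup_le fun i => ?_
    have h := fPiece_le_hMax (γ := γ) (ρ := ρ) (α := α) V i y
    refine le_trans ?_ (add_le_add_left h _)
    have : smaxLE ρ i (vecV γ V x) ≤ smaxLE ρ i (vecV γ V y) + L * dist x y := by
      refine smaxLE_le_add hρ fun j _ => ?_
      have h1 : inner ℝ (V j) x - inner ℝ (V j) y ≤ L * dist x y := by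
        rw [← inner_sub_right, dist_eq_norm]
        exact (real_inner_le_norm _ _).trans (by gcongr; exact hV j)
      simp only [vecV]
      linarith
    simp only [fPiece]
    linarith

theorem measurable_hMax :
    Measurable (Function.uncurry fun V : Fin k → E n => hMax γ ρ α V) := by
  have hvec : ∀ j : Fin k, Measurable fun q : (Fin k → E n) × E n => vecV γ q.1 q.2 j := by
    intro j
    have : Measurable fun q : (Fin k → E n) × E n => inner ℝ (q.1 j) q.2 :=
      ((measurable_pi_apply j).comp measurable_fst).inner measurable_snd
    exact this.add_const _
  refine Measurable.iSup fun i => ?_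
  simp only [fPiece, smaxLE]
  refine (Measurable.const_mul (Real.measurable_log.comp ?_) _).add_const _
  exact Finset.measurable_sum _ fun j _ => Real.measurable_exp.comp ((hvec j).div_const _)

/-- From `m` to `i` the softmax grows by at most `ρ(i-m)n^{-α}`, which is exactly the amount by
which the offset drops. -/
theorem fPiece_le_fPiece (hρ : 0 < ρ) (hγ : 0 ≤ γ)
    (hδ : Real.exp (-(3 / 10 * γ / ρ)) ≤ (n : ℝ) ^ (-α)) {V : Fin k → E n} {y : E n}
    {m i : Fin k} (hmi : m ≤ i) (h : ∀ l, m ≤ l → |inner ℝ (V l) y| ≤ 7 / 20 * γ) :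
    fPiece γ ρ α V i y ≤ fPiece γ ρ α V m y := by
  have key := smaxLE_le_add_mul hρ hmi (z := vecV γ V y) (δ := (n : ℝ) ^ (-α))
    (Real.rpow_nonneg (Nat.cast_nonneg _) _) (by
      intro l hml _
      refine le_trans ?_ hδ
      rw [Real.exp_le_exp, ← neg_div]
      gcongr
      -- The shifts separate the coordinates `m` and `l` by at least `γ`; the inner products recover
      -- at most `2 * (7/20)γ`, which leaves `3/10 * γ`.
      have h1 := (abs_le.1 (h l hml.le)).2
      have h2 := (abs_le.1 (h m le_rfl)).1
      have h3 : (m : ℝ) + 1 ≤ l := by exact_mod_cast hml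
      simp only [vecV]
      nlinarith)
  simp only [fPiece]
  linarith

/-- Pieces beyond `m` are dominated by piece `m`, and pieces up to `m` see only the common vectors.
Smallness is asked of one list only, so equality follows by exchanging the roles of the lists. -/
theorem hMax_le_hMax_of_small (hρ : 0 < ρ) (hγ : 0 ≤ γ)
    (hδ : Real.exp (-(3 / 10 * γ / ρ)) ≤ (n : ℝ) ^ (-α)) {V V' : Fin k → E n} {y : E n}
    (m : Fin k) (hV : ∀ i ≤ m, V i = V' i) (h : ∀ l, m ≤ l → |inner ℝ (V l) y| ≤ 7 / 20 * γ) :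
    hMax γ ρ α V y ≤ hMax γ ρ α V' y := by
  have : Nonempty (Fin k) := ⟨m⟩
  have hlow : ∀ i ≤ m, fPiece γ ρ α V i y ≤ hMax γ ρ α V' y := by
    intro i hi
    have : fPiece γ ρ α V i y = fPiece γ ρ α V' i y := by
      simp only [fPiece]
      congr 1
      exact smaxLE_congr fun j hj => by simp only [vecV, hV j (hj.trans hi)]
    rw [this]
    exact fPiece_le_hMax _ _ _
  refine ciSup_le fun i => ?_
  rcases le_total i m with hi | hi
  · exact hlow i hi
  · exact (fPiece_le_fPiece hρ hγ hδ hi h).trans (hlow m le_rfl)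

/-- The list `V` with all but the first `m` vectors replaced by zero. -/
def truncV (m : ℕ) (V : Fin k → E n) : Fin k → E n := fun i => if (i : ℕ) < m then V i else 0

theorem dependsOn_truncV (m : ℕ) :
    DependsOn (truncV (n := n) (k := k) m) {j | (j : ℕ) < m} := by
  intro V V' h
  funext i
  unfold truncV
  split_ifs with hi
  · exact h i hi
  · rfl

theorem measurable_truncV (m : ℕ) : Measurable (truncV (n := n) (k := k) m) := by
  refine measurable_pi_lambda _ fun i => ?_
  unfold truncV
  split_ifs
  · exact measurable_pi_apply i
  · exact measurable_const

theorem hMax_truncV (hρ : 0 < ρ) (hγ : 0 ≤ γ)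
    (hδ : Real.exp (-(3 / 10 * γ / ρ)) ≤ (n : ℝ) ^ (-α)) {V : Fin k → E n} {y : E n} {m : ℕ}
    (hm : m < k) (h : ∀ l : Fin k, m ≤ l → |inner ℝ (V l) y| ≤ 7 / 20 * γ) :
    hMax γ ρ α V y = hMax γ ρ α (truncV (m + 1) V) y := by
  have hag : ∀ i : Fin k, i ≤ ⟨m, hm⟩ → V i = truncV (m + 1) V i := by
    intro i hi
    have : (i : ℕ) < m + 1 := Nat.lt_succ_of_le hi
    simp [truncV, this]
  refine le_antisymm (hMax_le_hMax_of_small hρ hγ hδ ⟨m, hm⟩ hag fun l hl => h l hl)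
    (hMax_le_hMax_of_small hρ hγ hδ ⟨m, hm⟩ (fun i hi => (hag i hi).symm) fun l hl => ?_)
  unfold truncV
  split_ifs
  · exact h l hl
  · simp; positivity

end HMax

/-! ### The parameters -/

section Params

variable {c : ℝ} {n : ℕ}

theorem gam_pos_and_le_of_steps_pos (hc : 0 ≤ c) (h : 0 < steps c n) :
    0 < gam c n ∧ gam c n ≤ 1 / 10 := by
  have h1 : (1 : ℝ) ≤ ((1 / 10) / gam c n) ^ ((2 : ℝ) / 3) := Nat.floor_pos.1 h
  have hg0 : 0 ≤ gam c n := mul_nonneg hc (Real.sqrt_nonneg _)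
  have hg : 0 < gam c n := by
    refine lt_of_le_of_ne hg0 fun h0 => ?_
    -- When `γ = 0`, division by zero returns `0`, so `k` would be `0`.
    rw [← h0, div_zero, Real.zero_rpow (by norm_num)] at h1
    linarith
  refine ⟨hg, ?_⟩
  by_contra! hlt
  have h2 : (1 / 10) / gam c n < 1 := (div_lt_one hg).2 hlt
  have := Real.rpow_lt_one (by positivity) h2 (by norm_num : (0 : ℝ) < 2 / 3)
  linarith

theorem gam_sq : gam c n ^ 2 = c ^ 2 * (Real.log n / n) := by
  rw [gam, mul_pow, Real.sq_sqrt (div_nonneg (Real.log_natCast_nonneg n) (Nat.cast_nonneg n))]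

/-- This is the purpose of the exponent `2/3`: it says that the total shift `kγ` is at most `ε =
0.1/√k`. -/
theorem steps_cube_mul_le (hg : 0 < gam c n) : (steps c n : ℝ) ^ 3 * gam c n ^ 2 ≤ 1 / 100 := by
  have h1 : (steps c n : ℝ) ≤ ((1 / 10) / gam c n) ^ ((2 : ℝ) / 3) :=
    Nat.floor_le (by positivity)
  have h2 : (steps c n : ℝ) ^ 3 ≤ ((1 / 10) / gam c n) ^ 2 := by
    calc (steps c n : ℝ) ^ 3 ≤ (((1 / 10) / gam c n) ^ ((2 : ℝ) / 3)) ^ 3 := by gcongr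
      _ = _ := by
        rw [← Real.rpow_natCast, ← Real.rpow_mul (by positivity), ← Real.rpow_natCast]
        norm_num
  calc _ ≤ ((1 / 10) / gam c n) ^ 2 * gam c n ^ 2 := by gcongr
    _ = 1 / 100 := by field_simp; norm_num

theorem dim_facts_of_steps_pos (hc : 40 ≤ c) (h : 0 < steps c n) :
    10 ≤ Real.log n ∧ 2 ≤ n ∧ 2 * steps c n ≤ n := by
  obtain ⟨hg, hg1⟩ := gam_pos_and_le_of_steps_pos (by linarith) h
  have hc2 : 1600 ≤ c ^ 2 := by nlinarith
  have hsq := gam_sq (c := c) (n := n)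
  have hpos : 0 < Real.log n / n := by
    have : 0 < gam c n ^ 2 := by positivity
    rw [hsq] at this
    exact (pos_iff_pos_of_mul_pos this).1 (by positivity)
  have hn1 : 1 < n := by
    by_contra! hn
    interval_cases n <;> simp at hpos
  have hn0 : (0 : ℝ) < n := by positivity
  have hn2 : (2 : ℝ) ≤ n := by exact_mod_cast hn1
  have hlog : 0.69 ≤ Real.log n := by
    have := Real.log_le_log (by norm_num) hn2
    linarith [Real.log_two_gt_d9]
  -- Here `160000 = 100 * 40²`. The choice `u = 1` makes `n` large enough for `log n ≥ 10`, and `u =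
  -- k³ ≥ k` gives `2k ≤ n`.
  have hcl : ∀ u : ℝ, u * gam c n ^ 2 ≤ 1 / 100 → 0 ≤ u → u * 160000 * Real.log n ≤ n := by
    intro u hu hu0
    rw [hsq] at hu
    have h1 : u * (c ^ 2 * Real.log n) ≤ 1 / 100 * n := by
      have := mul_le_mul_of_nonneg_right hu hn0.le
      calc _ = u * (c ^ 2 * (Real.log n / n)) * n := by field_simp
        _ ≤ _ := this
    have h2 : 1600 * Real.log n ≤ c ^ 2 * Real.log n := by gcongr
    nlinarith [mul_le_mul_of_nonneg_left h2 hu0]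
  have hbig := hcl 1 (by nlinarith) zero_le_one
  refine ⟨?_, hn1, ?_⟩
  · rw [Real.le_log_iff_exp_le hn0]
    have h1 : Real.exp 10 = Real.exp 1 ^ 10 := by rw [← Real.exp_nat_mul]; norm_num
    have h2 : Real.exp 1 ^ 10 ≤ 2.72 ^ 10 := by
      gcongr
      linarith [Real.exp_one_lt_d9]
    rw [h1]
    refine h2.trans ?_
    norm_num
    linarith
  · have h1 := hcl _ (steps_cube_mul_le hg) (by positivity)
    have hk : (1 : ℝ) ≤ steps c n := by exact_mod_cast h
    have hk3 : (steps c n : ℝ) ≤ (steps c n : ℝ) ^ 3 := le_self_pow₀ hk (by norm_num)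
    have : (2 * steps c n : ℝ) ≤ n := by nlinarith
    exact_mod_cast this

theorem bet_pos_and_le (hc : 40 ≤ c) (h : 0 < steps c n) :
    0 < bet c n ∧ bet c n ≤ gam c n / 10 := by
  obtain ⟨hg, -⟩ := gam_pos_and_le_of_steps_pos (by linarith) h
  obtain ⟨hl, -, -⟩ := dim_facts_of_steps_pos hc h
  exact ⟨div_pos hg (by linarith), by unfold bet; gcongr⟩

theorem one_le_alph (p : ℕ) : 1 ≤ alph p := by
  unfold alph
  have : (0 : ℝ) ≤ p := p.cast_nonneg
  linarith

theorem rho_pos (p : ℕ) (hc : 40 ≤ c) (h : 0 < steps c n) : 0 < rho c p n := by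
  obtain ⟨hg, -⟩ := gam_pos_and_le_of_steps_pos (by linarith) h
  obtain ⟨hl, -, -⟩ := dim_facts_of_steps_pos hc h
  have := one_le_alph p
  unfold rho
  positivity

theorem exp_neg_gam_div_rho_le (p : ℕ) (hc : 40 ≤ c) (h : 0 < steps c n) :
    Real.exp (-(3 / 10 * gam c n / rho c p n)) ≤ (n : ℝ) ^ (-alph p) := by
  obtain ⟨hg, -⟩ := gam_pos_and_le_of_steps_pos (by linarith) h
  obtain ⟨hl, hn, -⟩ := dim_facts_of_steps_pos hc h
  have ha := one_le_alph p
  have e : 3 / 10 * gam c n / rho c p n = 30 * alph p * Real.log n := by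
    unfold rho; field_simp; norm_num
  rw [e, Real.rpow_def_of_pos (by positivity)]
  gcongr
  have : 0 ≤ alph p * Real.log n := by positivity
  nlinarith

/-! ### Locality and optimality for the hard function -/

variable {p : ℕ}

/-- Within distance `β ≤ γ/10` of `x` the inner products stay below `γ/4 + γ/10 = 7/20 * γ`, the
threshold of `hMax_truncV`. -/
theorem oracle_hardFun_truncV (hc : 40 ≤ c) (h : 0 < steps c n) {V : Fin (steps c n) → E n}
    (hV : ∀ i, ‖V i‖ ≤ 1) {m : ℕ} (hm : m < steps c n) (x : Ball n)
    (hx : ∀ i : Fin (steps c n), m ≤ i → |inner ℝ (V i) (x : E n)| ≤ gam c n / 4) :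
    oracle p (hardFun c p n V) x = oracle p (hardFun c p n (truncV (m + 1) V)) x := by
  obtain ⟨hg, -⟩ := gam_pos_and_le_of_steps_pos (by linarith) h
  obtain ⟨hb, hb1⟩ := bet_pos_and_le hc h
  refine oracle_smoothing_congr hb p x fun y hy => ?_
  refine hMax_truncV (rho_pos p hc h) hg.le (exp_neg_gam_div_rho_le p hc h) hm fun l hl => ?_
  have h1 : inner ℝ (V l) y = inner ℝ (V l) (x : E n) + inner ℝ (V l) (y - x) := by
    rw [← inner_add_right, add_sub_cancel]
  have h2 : |inner ℝ (V l) (y - x)| ≤ bet c n := by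
    refine (abs_real_inner_le_norm _ _).trans ?_
    rw [Metric.mem_ball, dist_eq_norm] at hy
    have := mul_le_mul (hV l) hy.le (norm_nonneg _) zero_le_one
    linarith
  rw [h1]
  have := abs_add_le (inner ℝ (V l) (x : E n)) (inner ℝ (V l) (y - x))
  linarith [hx l hl]

/-- Arbitrary lists are allowed because measurability of the oracle is proved on the space of all
lists; the sum of the norms serves as Lipschitz constant. -/
theorem contDiff_hardFun (hc : 40 ≤ c) (h : 0 < steps c n) (V : Fin (steps c n) → E n) :
    ContDiff ℝ p (hardFun c p n V) := by
  have hL : ∀ j, ‖V j‖ ≤ ((∑ j, ‖V j‖₊ : NNReal) : ℝ) := by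
    intro j
    rw [← coe_nnnorm, NNReal.coe_le_coe]
    exact Finset.single_le_sum (f := fun j => ‖V j‖₊) (fun _ _ => zero_le) (Finset.mem_univ j)
  exact contDiff_smoothing (bet_pos_and_le hc h).1 (lipschitzWith_hMax (rho_pos p hc h) hL) p

theorem measurable_hardFun (hc : 40 ≤ c) (h : 0 < steps c n) :
    Measurable (Function.uncurry (hardFun c p n)) :=
  measurable_smoothing_param (bet_pos_and_le hc h).1 measurable_hMax p

theorem measurable_oracle_hardFun (hc : 40 ≤ c) (h : 0 < steps c n) :
    Measurable fun q : (Fin (steps c n) → E n) × Ball n => oracle p (hardFun c p n q.1) q.2 := by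
  rw [measurable_pi_iff]
  intro i
  rw [measurable_pi_iff]
  intro s
  have hm := measurable_iteratedFDeriv_param (measurable_hardFun (p := p) hc h)
    (contDiff_hardFun hc h) i (Nat.lt_succ_iff.1 i.2)
    (fun j => EuclideanSpace.single (s j) (1 : ℝ))
  have hq : Measurable fun q : (Fin (steps c n) → E n) × Ball n => (q.1, (q.2 : E n)) := by
    exact measurable_fst.prodMk (measurable_subtype_coe.comp measurable_snd)
  have h3 := hm.comp hq
  simp only [oracle]
  exact h3

theorem le_hMax_of_last {k : ℕ} {γ ρ α : ℝ} (hρ : 0 < ρ) (V : Fin k → E n) {i : Fin k}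
    (hi : (i : ℕ) + 1 = k) (x : E n) : inner ℝ (V i) x ≤ hMax γ ρ α V x := by
  have h1 : (k : ℝ) - ((i : ℝ) + 1) = 0 := by
    rw [sub_eq_zero]; exact_mod_cast hi.symm
  refine le_trans ?_ (fPiece_le_hMax V i x)
  have := le_smaxLE hρ (le_refl i) (vecV γ V x)
  simp only [vecV, h1, zero_mul, add_zero] at this
  simpa only [fPiece, h1, mul_zero, zero_mul, add_zero] using this

theorem hMax_le_of_inner_le {k : ℕ} {γ ρ α M : ℝ} (hγ : 0 ≤ γ) (hρ : 0 < ρ) (hk : 0 < k)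
    (V : Fin k → E n) {y : E n} (hy : ∀ j, inner ℝ (V j) y ≤ M) :
    hMax γ ρ α V y ≤ M + k * γ + ρ * Real.log k + ρ * k * (n : ℝ) ^ (-α) := by
  have : Nonempty (Fin k) := ⟨⟨0, hk⟩⟩
  refine ciSup_le fun i => ?_
  have h1 : smaxLE ρ i (vecV γ V y) ≤ M + k * γ + ρ * Real.log k := by
    refine smaxLE_le hρ fun j _ => ?_
    have : 0 ≤ ((j : ℝ) + 1) * γ := by positivity
    simp only [vecV]
    linarith [hy j]
  have h2 : ρ * ((k : ℝ) - ((i : ℝ) + 1)) * (n : ℝ) ^ (-α) ≤ ρ * k * (n : ℝ) ^ (-α) := by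
    gcongr
    have : (0 : ℝ) ≤ (i : ℝ) := Nat.cast_nonneg _
    linarith
  simp only [fPiece]
  linarith

theorem exists_ball_inner_eq {k : ℕ} (hk : 0 < k) {V : Fin k → E n} (hV : Orthonormal ℝ V) :
    ∃ y : Ball n, ∀ j, inner ℝ (V j) (y : E n) = -(1 / Real.sqrt k) := by
  have hk0 : (0 : ℝ) < k := by exact_mod_cast hk
  have hs : 0 < Real.sqrt k := Real.sqrt_pos.2 hk0
  set y : E n := ∑ j, (-(1 / Real.sqrt k)) • V j with hy
  have hin : ∀ j, inner ℝ (V j) y = -(1 / Real.sqrt k) := fun j =>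
    hV.inner_right_fintype (fun _ => -(1 / Real.sqrt k)) j
  have hnorm : ‖y‖ ^ 2 = 1 := by
    rw [← real_inner_self_eq_norm_sq]
    nth_rewrite 1 [hy]
    rw [sum_inner]
    simp only [real_inner_smul_left, hin, Finset.sum_const, Finset.card_univ, Fintype.card_fin,
      nsmul_eq_mul]
    field_simp
    rw [Real.sq_sqrt hk0.le]
  refine ⟨⟨y, ?_⟩, hin⟩
  have : ‖y‖ = 1 := (pow_eq_one_iff_of_nonneg (norm_nonneg y) two_ne_zero).1 hnorm
  simp [this]

/-- The last piece gives `h(x) ≥ -γ/4`, while at `y = -(∑ v_j)/√k` one has `h(y) ≤ -1/√k + kγ +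
γ/50`. Smoothing costs `2β ≤ γ/5`. Since `γ ≤ kγ ≤ 0.1/√k`, all losses together are below `0.15/√k`,
and the gap exceeds `ε`. -/
theorem not_isEpsOptimal_hardFun (hc : 40 ≤ c) (h : 0 < steps c n) {V : Fin (steps c n) → E n}
    (hV : Orthonormal ℝ V) (x : Ball n) {i : Fin (steps c n)} (hi : (i : ℕ) + 1 = steps c n)
    (hx : |inner ℝ (V i) (x : E n)| ≤ gam c n / 4) :
    ¬ IsEpsOptimal (eps c n) (hardFun c p n V) x := by
  obtain ⟨hg, -⟩ := gam_pos_and_le_of_steps_pos (by linarith) h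
  obtain ⟨hl, hn, hkn⟩ := dim_facts_of_steps_pos hc h
  obtain ⟨hb, hb1⟩ := bet_pos_and_le hc h
  have hρ := rho_pos p hc h
  have ha := one_le_alph p
  obtain ⟨y, hy⟩ := exists_ball_inner_eq h hV
  have hlip : LipschitzWith 1 (hMax (gam c n) (rho c p n) (alph p) V) :=
    lipschitzWith_hMax hρ fun j => by simp [hV.1 j]
  have hsm : ∀ z, |hardFun c p n V z - hMax (gam c n) (rho c p n) (alph p) V z| ≤ bet c n := by
    intro z
    refine (abs_smoothing_sub_le hb hlip p z).trans ?_
    have : 0 ≤ bet c n * (1 / 2 ^ p) := by positivity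
    linarith
  have h1 := (abs_le.1 (hsm x)).1
  have h2 := (abs_le.1 (hsm y)).2
  have h3 := le_hMax_of_last (γ := gam c n) (α := alph p) hρ V hi (x : E n)
  have h4 := hMax_le_of_inner_le (γ := gam c n) (α := alph p) hg.le hρ h V fun j => (hy j).le
  have h5 := (abs_le.1 hx).1
  set k := steps c n
  have hk1 : (1 : ℝ) ≤ k := by exact_mod_cast h
  have hn0 : (0 : ℝ) < n := by positivity
  have hkn' : (k : ℝ) ≤ n := by exact_mod_cast (by omega : k ≤ n)
  have h6 : rho c p n * Real.log k ≤ gam c n / 100 := by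
    calc rho c p n * Real.log k ≤ rho c p n * Real.log n := by gcongr
      _ = gam c n / (100 * alph p) := by unfold rho; field_simp
      _ ≤ _ := by gcongr; linarith
  have h7 : rho c p n * k * (n : ℝ) ^ (-alph p) ≤ gam c n / 100 := by
    have e1 : (n : ℝ) ^ (-alph p) ≤ (n : ℝ)⁻¹ := by
      rw [← Real.rpow_neg_one]
      exact Real.rpow_le_rpow_of_exponent_le (by linarith) (by linarith)
    have e2 : (k : ℝ) * (n : ℝ) ^ (-alph p) ≤ 1 := by
      calc (k : ℝ) * (n : ℝ) ^ (-alph p) ≤ n * (n : ℝ)⁻¹ := by gcongr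
        _ = 1 := mul_inv_cancel₀ hn0.ne'
    have e3 : rho c p n ≤ gam c n / 100 := by
      unfold rho
      gcongr
      nlinarith
    calc rho c p n * k * (n : ℝ) ^ (-alph p) = rho c p n * (k * (n : ℝ) ^ (-alph p)) := by ring
      _ ≤ rho c p n * 1 := by gcongr
      _ ≤ _ := by linarith
  have hs : 1 ≤ Real.sqrt k := Real.one_le_sqrt.2 hk1
  have hs0 : 0 < Real.sqrt k := by linarith
  have h8 : k * gam c n ≤ (1 / 10) * (1 / Real.sqrt k) := by
    have hcube := steps_cube_mul_le hg
    have : (k * gam c n * Real.sqrt k) ^ 2 ≤ (1 / 10) ^ 2 := by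
      rw [mul_pow, Real.sq_sqrt (by linarith)]
      nlinarith
    have := le_of_sq_le_sq this (by norm_num)
    rw [mul_one_div, le_div_iff₀ hs0]
    exact this
  have h9 : gam c n ≤ k * gam c n := le_mul_of_one_le_left hg.le hk1
  have hs' : 0 < 1 / Real.sqrt k := by positivity
  intro hopt
  have h10 := hopt y
  have heps : eps c n = (1 / 10) * (1 / Real.sqrt k) := by unfold eps; ring
  rw [heps] at h10
  linarith

end Params

/-! ### Tail bound in terms of the parameters -/

/-- Bound for the probability that a vector of the frame has inner product more than `γ / 4` with a
vector chosen without knowledge of it. -/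
def tailBound (c : ℝ) (n : ℕ) : ℝ := 2 * Real.exp (-(c ^ 2 / 64 * Real.log n))

theorem tailBound_nonneg (c : ℝ) (n : ℕ) : 0 ≤ tailBound c n := by unfold tailBound; positivity

theorem tailBound_le {c : ℝ} {n : ℕ} (hn : 0 < n) {N : ℕ} (hN : (N : ℝ) ≤ c ^ 2 / 64) :
    tailBound c n ≤ 2 / (n : ℝ) ^ N := by
  have hn0 : (0 : ℝ) < n := by positivity
  have hl : 0 ≤ Real.log n := Real.log_natCast_nonneg n
  have : Real.exp (-(c ^ 2 / 64 * Real.log n)) ≤ ((n : ℝ) ^ N)⁻¹ := by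
    calc _ ≤ Real.exp (-(N * Real.log n)) := by gcongr
      _ = _ := by rw [Real.exp_neg, Real.exp_nat_mul, Real.exp_log hn0]
  unfold tailBound
  rw [div_eq_mul_inv]
  exact mul_le_mul_of_nonneg_left this zero_le_two

section

variable {c : ℝ} {n : ℕ}

theorem lintegral_indicator_inner_gam_le (hc : 40 ≤ c) (h : 0 < steps c n) {m : ℕ}
    (i : Fin (steps c n)) (hmi : m ≤ i)
    (w : (Fin (steps c n) → E n) → ℝ≥0∞) (hw : Measurable w)
    (hwd : DependsOn w {j | (j : ℕ) < m})
    (x : (Fin (steps c n) → E n) → Ball n) (hx : Measurable x)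
    (hxd : DependsOn x {j | (j : ℕ) < m}) :
    ∫⁻ V, {V | gam c n / 4 < |inner ℝ (V i) (x V : E n)|}.indicator w V
        ∂haarFrame n (steps c n) ≤
      ENNReal.ofReal (tailBound c n) * ∫⁻ V, w V ∂haarFrame n (steps c n) := by
  obtain ⟨hg, -⟩ := gam_pos_and_le_of_steps_pos (by linarith) h
  obtain ⟨hl, hn, hkn⟩ := dim_facts_of_steps_pos hc h
  have h1 := lintegral_indicator_inner_le (by omega) i hmi w hw hwd (fun V => (x V : E n))
    (measurable_subtype_coe.comp hx) (fun V V' hV => congrArg _ (hxd hV))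
    (fun V => mem_closedBall_zero_iff.1 (x V).2) (gam c n / 4) (by positivity)
  refine h1.trans ?_
  gcongr
  rw [tailBound, ENNReal.ofReal_mul zero_le_two, ENNReal.ofReal_ofNat]
  gcongr
  have hn0 : (0 : ℝ) < n := by positivity
  -- At least half of the dimensions are still unrevealed, since `2k ≤ n`; this turns the exponent
  -- into `γ²n/64 = (c²/64) ln n`.
  have hm : (n : ℝ) / 2 ≤ n - m := by
    have : 2 * m ≤ n := by have := i.2; omega
    have : (2 * m : ℝ) ≤ n := by exact_mod_cast this
    linarith
  have e : c ^ 2 / 64 * Real.log n = (gam c n / 4) ^ 2 * (n / 2) / 2 := by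
    rw [div_pow, gam_sq]; field_simp; norm_num
  rw [e]
  gcongr

theorem prod_measure_inner_gam_le (hc : 40 ≤ c) (h : 0 < steps c n) {m : ℕ}
    (i : Fin (steps c n)) (hmi : m ≤ i) {Ω : Type*} [MeasurableSpace Ω] (P : Measure Ω)
    [IsProbabilityMeasure P] (x : Ω × (Fin (steps c n) → E n) → Ball n) (hx : Measurable x)
    (hxd : ∀ ω, DependsOn (fun V => x (ω, V)) {j | (j : ℕ) < m}) :
    (P.prod (haarFrame n (steps c n))) {z | gam c n / 4 < |inner ℝ (z.2 i) (x z : E n)|} ≤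
      ENNReal.ofReal (tailBound c n) := by
  have hin : Measurable fun z : Ω × (Fin (steps c n) → E n) => inner ℝ (z.2 i) (x z : E n) :=
    ((measurable_pi_apply i).comp measurable_snd).inner (measurable_subtype_coe.comp hx)
  have hmeas : MeasurableSet {z : Ω × (Fin (steps c n) → E n) |
      gam c n / 4 < |inner ℝ (z.2 i) (x z : E n)|} :=
    measurableSet_lt measurable_const (continuous_abs.measurable.comp hin)
  rw [Measure.prod_apply hmeas]
  have hsec : ∀ ω, haarFrame n (steps c n) (Prod.mk ω ⁻¹' {z : Ω × (Fin (steps c n) → E n) |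
      gam c n / 4 < |inner ℝ (z.2 i) (x z : E n)|}) ≤ ENNReal.ofReal (tailBound c n) := by
    intro ω
    have h1 := lintegral_indicator_inner_gam_le hc h i hmi (fun _ => 1) measurable_const
      (fun _ _ _ => rfl) (fun V => x (ω, V)) (hx.comp measurable_prodMk_left) (hxd ω)
    rw [lintegral_const, measure_univ, mul_one, mul_one] at h1
    refine le_trans (le_of_eq ?_) h1
    rw [← lintegral_indicator_one (measurable_prodMk_left hmeas)]
    rfl
  calc _ ≤ ∫⁻ _ω, ENNReal.ofReal (tailBound c n) ∂P := lintegral_mono hsec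
    _ = _ := by simp

end

/-- The oracle of the hard function that only knows the first `j + 1` vectors. -/
def hybridOracle (c : ℝ) (p n : ℕ) (V : Fin (steps c n) → E n) (j : ℕ) : Ball n → Answer p n :=
  oracle p (hardFun c p n (truncV (j + 1) V))

theorem measurable_hybridOracle {c : ℝ} {p n : ℕ} (hc : 40 ≤ c) (h : 0 < steps c n) (j : ℕ) :
    Measurable fun q : (Fin (steps c n) → E n) × Ball n => hybridOracle c p n q.1 j q.2 := by
  have h1 := measurable_oracle_hardFun (p := p) hc h
  have h2 : Measurable fun q : (Fin (steps c n) → E n) × Ball n => (truncV (j + 1) q.1, q.2) :=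
    ((measurable_truncV (j + 1)).comp measurable_fst).prodMk measurable_snd
  have h3 := h1.comp h2
  exact h3

theorem hybridOracle_congr {c : ℝ} {p n m : ℕ} {V V' : Fin (steps c n) → E n}
    (hV : ∀ i : Fin (steps c n), (i : ℕ) < m → V i = V' i) {j : ℕ} (hj : j < m) :
    hybridOracle c p n V j = hybridOracle c p n V' j := by
  have : truncV (j + 1) V = truncV (j + 1) V' :=
    dependsOn_truncV (j + 1) fun i hi => hV i (lt_of_lt_of_le (show (i : ℕ) < j + 1 from hi) hj)
  rw [hybridOracle, this, hybridOracle]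

/-! ### Parallel algorithms with a different oracle in every round -/

namespace ParallelAlgorithm

variable {p n K r : ℕ} {Ω : Type*} [MeasurableSpace Ω]

/-- The answers in the first `j` rounds of a run in which round `i` uses the oracle `O i`. -/
def hybridAnswers (A : ParallelAlgorithm p n K r Ω) (O : ℕ → Ball n → Answer p n) (ω : Ω) :
    (j : ℕ) → Fin j → Fin K → Answer p n
  | 0 => Fin.elim0
  | j + 1 => Fin.snoc (hybridAnswers A O ω j) fun l => O j (A.query j (ω, hybridAnswers A O ω j) l)

/-- Agreement is needed only at the queries of the hybrid run, which do not depend on the vectors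
still hidden from it. -/
theorem answers_eq_hybridAnswers (A : ParallelAlgorithm p n K r Ω) (F : Ball n → Answer p n)
    (O : ℕ → Ball n → Answer p n) (ω : Ω) (m : ℕ)
    (h : ∀ j < m, ∀ l, F (A.query j (ω, A.hybridAnswers O ω j) l) =
      O j (A.query j (ω, A.hybridAnswers O ω j) l)) :
    A.answers F ω m = A.hybridAnswers O ω m := by
  induction m with
  | zero => rfl
  | succ m ih =>
    have h1 := ih fun j hj => h j (by omega)
    simp only [answers, hybridAnswers, h1]
    congr 1
    exact funext fun l => h m (by omega) l

theorem hybridAnswers_congr (A : ParallelAlgorithm p n K r Ω) (O O' : ℕ → Ball n → Answer p n)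
    (ω : Ω) (m : ℕ) (h : ∀ j < m, O j = O' j) :
    A.hybridAnswers O ω m = A.hybridAnswers O' ω m := by
  induction m with
  | zero => rfl
  | succ m ih => simp only [hybridAnswers, ih fun j hj => h j (by omega), h m (by omega)]

theorem measurable_hybridAnswers (A : ParallelAlgorithm p n K r Ω) {X : Type*}
    [MeasurableSpace X] (O : X → ℕ → Ball n → Answer p n)
    (hO : ∀ j, Measurable fun q : X × Ball n => O q.1 j q.2) (m : ℕ) :
    Measurable fun q : Ω × X => A.hybridAnswers (O q.2) q.1 m := by
  induction m with
  | zero => exact measurable_pi_lambda _ fun i => i.elim0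
  | succ m ih =>
    refine measurable_pi_lambda _ fun i => ?_
    induction i using Fin.lastCases with
    | last =>
      simp only [hybridAnswers, Fin.snoc_last]
      refine measurable_pi_lambda _ fun l => ?_
      have hq : Measurable fun q : Ω × X => A.query m (q.1, A.hybridAnswers (O q.2) q.1 m) l :=
        (measurable_pi_apply l).comp ((A.measurable_query m).comp (measurable_fst.prodMk ih))
      exact (hO m).comp (measurable_snd.prodMk hq)
    | cast i =>
      simp only [hybridAnswers, Fin.snoc_castSucc]
      exact (measurable_pi_apply i).comp ih

/-- Union bound over all triples of round, query and vector, plus one event for the output. The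
success event need not be measurable; it is only contained in the union of bad events. -/
theorem success_le (A : ParallelAlgorithm p n K r Ω) (P : Measure Ω) [IsProbabilityMeasure P]
    {c : ℝ} (hc : 40 ≤ c) (hr : r < steps c n) :
    A.success P c ≤ (r * (K * steps c n) + 1 : ℕ) * ENNReal.ofReal (tailBound c n) := by
  have h : 0 < steps c n := by omega
  obtain ⟨-, -, hkn⟩ := dim_facts_of_steps_pos hc h
  have hOm := measurable_hybridOracle (p := p) hc h
  set q : (j : ℕ) → Fin K → Ω × (Fin (steps c n) → E n) → Ball n :=
    fun j l z => A.query j (z.1, A.hybridAnswers (hybridOracle c p n z.2) z.1 j) l with hq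
  have hqm : ∀ j l, Measurable (q j l) := fun j l =>
    (measurable_pi_apply l).comp ((A.measurable_query j).comp
      (measurable_fst.prodMk (A.measurable_hybridAnswers _ hOm j)))
  have hqd : ∀ j l ω, DependsOn (fun V => q j l (ω, V)) {i | (i : ℕ) < j} := by
    intro j l ω V V' hV
    simp only [hq]
    rw [A.hybridAnswers_congr _ _ ω j fun i hi => hybridOracle_congr hV hi]
  set o : Ω × (Fin (steps c n) → E n) → Ball n :=
    fun z => A.output (z.1, A.hybridAnswers (hybridOracle c p n z.2) z.1 r) with ho
  have hom : Measurable o :=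
    A.measurable_output.comp (measurable_fst.prodMk (A.measurable_hybridAnswers _ hOm r))
  have hod : ∀ ω, DependsOn (fun V => o (ω, V)) {i | (i : ℕ) < r} := by
    intro ω V V' hV
    simp only [ho]
    rw [A.hybridAnswers_congr _ _ ω r fun i hi => hybridOracle_congr hV hi]
  set last : Fin (steps c n) := ⟨steps c n - 1, by omega⟩ with hlast
  set μ := P.prod (haarFrame n (steps c n)) with hμ
  set B : Fin r × Fin K × Fin (steps c n) → Set (Ω × (Fin (steps c n) → E n)) := fun t =>
    {z | (t.1 : ℕ) ≤ t.2.2 ∧ gam c n / 4 < |inner ℝ (z.2 t.2.2) (q t.1 t.2.1 z : E n)|} with hB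
  set D : Set (Ω × (Fin (steps c n) → E n)) :=
    {z | gam c n / 4 < |inner ℝ (z.2 last) (o z : E n)|} with hD
  set N : Set (Ω × (Fin (steps c n) → E n)) := {z | ¬ Orthonormal ℝ z.2} with hN
  have hN0 : μ N = 0 := by
    have := Measure.quasiMeasurePreserving_snd (μ := P) (ν := haarFrame n (steps c n)) |>.ae
      (ae_orthonormal_haarFrame (n := n) (k := steps c n) (by omega))
    exact this
  have hBle : ∀ t, μ (B t) ≤ ENNReal.ofReal (tailBound c n) := by
    intro t
    by_cases ht : (t.1 : ℕ) ≤ t.2.2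
    · simp only [hB, ht, true_and]
      exact prod_measure_inner_gam_le hc h t.2.2 ht P _ (hqm _ _) (hqd _ _)
    · simp [hB, ht]
  have hDle : μ D ≤ ENNReal.ofReal (tailBound c n) :=
    -- This is where `r < k` matters: the hybrid output depends on the first `r ≤ k - 1` vectors,
    -- hence not on the last one.
    prod_measure_inner_gam_le hc h last (m := r) (by simp only [hlast]; omega) P o hom hod
  have hsub : {z : Ω × (Fin (steps c n) → E n) | IsEpsOptimal (eps c n) (hardFun c p n z.2)
      (A.result (oracle p (hardFun c p n z.2)) z.1)} ⊆ N ∪ ((⋃ t, B t) ∪ D) := by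
    intro z hz
    by_contra hcon
    simp only [mem_union, mem_iUnion, not_or, not_exists] at hcon
    obtain ⟨h1, h2, h3⟩ := hcon
    have hort : Orthonormal ℝ z.2 := by simpa [hN] using h1
    have heq : A.answers (oracle p (hardFun c p n z.2)) z.1 r = A.hybridAnswers (hybridOracle c p n z.2) z.1 r := by
      refine A.answers_eq_hybridAnswers _ _ _ _ fun j hj l => ?_
      refine oracle_hardFun_truncV hc h (fun i => (hort.1 i).le) (by omega) _ fun i hi => ?_
      by_contra! hlt
      exact h2 (⟨j, hj⟩, l, i) ⟨hi, hlt⟩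
    have hres : A.result (oracle p (hardFun c p n z.2)) z.1 = o z := by
      simp only [result, heq, ho]
    have hz' : IsEpsOptimal (eps c n) (hardFun c p n z.2)
      (A.result (oracle p (hardFun c p n z.2)) z.1) := hz
    rw [hres] at hz'
    refine not_isEpsOptimal_hardFun hc h hort (o z) (i := last) (by simp only [hlast]; omega) ?_ hz'
    by_contra! hlt
    exact h3 hlt
  calc A.success P c ≤ μ (N ∪ ((⋃ t, B t) ∪ D)) := measure_mono hsub
    _ ≤ μ N + (μ (⋃ t, B t) + μ D) :=
      (measure_union_le _ _).trans (add_le_add le_rfl (measure_union_le _ _))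
    _ ≤ 0 + (∑ t, μ (B t) + ENNReal.ofReal (tailBound c n)) := by
      rw [hN0]; gcongr; exact measure_iUnion_fintype_le μ B
    _ ≤ 0 + (∑ _t : Fin r × Fin K × Fin (steps c n), ENNReal.ofReal (tailBound c n) +
          ENNReal.ofReal (tailBound c n)) := by
      gcongr with t; exact hBle t
    _ = _ := by
      simp [Finset.sum_const]
      ring

/-- Fewer than `k` rounds give success probability at most `K n⁻ᵈ`, when `c` is large. -/
theorem success_le_div (A : ParallelAlgorithm p n K r Ω) (P : Measure Ω) [IsProbabilityMeasure P]
    {c : ℝ} (hc : 40 ≤ c) {d : ℕ} (hd : (d : ℝ) + 4 ≤ c ^ 2 / 64) (hK : 1 ≤ K)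
    (hr : r < steps c n) :
    A.success P c ≤ ENNReal.ofReal ((K : ℝ) / (n : ℝ) ^ d) := by
  refine (A.success_le P hc hr).trans ?_
  obtain ⟨-, hn, hkn⟩ := dim_facts_of_steps_pos hc (Nat.zero_lt_of_lt hr)
  have hn0 : (0 : ℝ) < n := by positivity
  rw [← ENNReal.ofReal_natCast, ← ENNReal.ofReal_mul (by positivity)]
  refine ENNReal.ofReal_le_ofReal ?_
  -- Of the four extra powers of `n`, three pay for the number of events and one for the factor `2`.
  have ht := tailBound_le (c := c) (n := n) (by omega) (N := d + 4) (by push_cast; exact hd)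
  have hcount : r * (K * steps c n) + 1 ≤ K * n ^ 3 := by
    have h1 : r * (K * steps c n) ≤ n * (K * n) := by
      gcongr <;> omega
    have h2 : 1 ≤ K * n ^ 2 := Nat.mul_pos (by omega) (by positivity)
    calc _ ≤ n * (K * n) + K * n ^ 2 := by omega
      _ = K * n ^ 2 * 2 := by ring
      _ ≤ K * n ^ 2 * n := by gcongr
      _ = _ := by ring
  have hcount' : ((r * (K * steps c n) + 1 : ℕ) : ℝ) ≤ K * n ^ 3 := by exact_mod_cast hcount
  have hn2 : (2 : ℝ) ≤ n := by exact_mod_cast hn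
  calc _ ≤ (K * n ^ 3) * (2 / (n : ℝ) ^ (d + 4)) :=
        mul_le_mul hcount' ht (tailBound_nonneg _ _) (by positivity)
    _ ≤ (K * n ^ 3) * (n / (n : ℝ) ^ (d + 4)) := by gcongr
    _ = _ := by field_simp; ring

end ParallelAlgorithm

/-! ### Quantum algorithms with a different oracle for every query -/

namespace QuantumAlgorithm

variable {p n : ℕ} {X A W : Type} [Fintype X] [DecidableEq X]
  [Fintype A] [DecidableEq A] [AddCommGroup A] [Fintype W] [DecidableEq W]

/-- The Euclidean norm of a state. -/
def stateNorm {Z : Type} [Fintype Z] (ψ : Z → ℂ) : ℝ := ‖(WithLp.toLp 2 ψ : EuclideanSpace ℂ Z)‖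

theorem stateNorm_sq {Z : Type} [Fintype Z] (ψ : Z → ℂ) : stateNorm ψ ^ 2 = ∑ z, ‖ψ z‖ ^ 2 := by
  rw [stateNorm, EuclideanSpace.norm_sq_eq]

theorem stateNorm_nonneg {Z : Type} [Fintype Z] (ψ : Z → ℂ) : 0 ≤ stateNorm ψ := norm_nonneg _

theorem stateNorm_add_le {Z : Type} [Fintype Z] (ψ φ : Z → ℂ) :
    stateNorm (ψ + φ) ≤ stateNorm ψ + stateNorm φ :=
  norm_add_le (WithLp.toLp 2 ψ : EuclideanSpace ℂ Z) (WithLp.toLp 2 φ)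

theorem stateNorm_sub_le {Z : Type} [Fintype Z] (ψ φ : Z → ℂ) :
    stateNorm (ψ - φ) ≤ stateNorm ψ + stateNorm φ :=
  norm_sub_le (WithLp.toLp 2 ψ : EuclideanSpace ℂ Z) (WithLp.toLp 2 φ)

theorem stateNorm_mulVec {Z : Type} [Fintype Z] [DecidableEq Z] (U : Matrix.unitaryGroup Z ℂ)
    (ψ : Z → ℂ) : stateNorm (Matrix.mulVec U.1 ψ) = stateNorm ψ := by
  have key : ∀ φ : Z → ℂ, ((∑ z, ‖φ z‖ ^ 2 : ℝ) : ℂ) = star φ ⬝ᵥ φ := by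
    intro φ
    rw [dotProduct]
    push_cast
    refine Finset.sum_congr rfl fun z _ => ?_
    rw [Pi.star_apply, ← Complex.conj_mul']
    rfl
  have hsq : stateNorm (Matrix.mulVec U.1 ψ) ^ 2 = stateNorm ψ ^ 2 := by
    rw [stateNorm_sq, stateNorm_sq]
    apply Complex.ofReal_injective
    rw [key, key, Matrix.star_mulVec, Matrix.dotProduct_mulVec, Matrix.vecMul_vecMul,
      ← Matrix.star_eq_conjTranspose, Matrix.UnitaryGroup.star_mul_self, Matrix.vecMul_one]
  exact (pow_left_inj₀ (stateNorm_nonneg _) (stateNorm_nonneg _) two_ne_zero).1 hsq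

theorem stateNorm_oracleUnitary (B : QuantumAlgorithm p n X A W) (F : Ball n → Answer p n)
    (ψ : X × A × W → ℂ) : stateNorm (B.oracleUnitary F ψ) = stateNorm ψ := by
  have hsq : stateNorm (B.oracleUnitary F ψ) ^ 2 = stateNorm ψ ^ 2 := by
    rw [stateNorm_sq, stateNorm_sq]
    exact Equiv.sum_comp (B.oraclePerm F).symm fun z => ‖ψ z‖ ^ 2
  exact (pow_left_inj₀ (stateNorm_nonneg _) (stateNorm_nonneg _) two_ne_zero).1 hsq

theorem oracleUnitary_sub (B : QuantumAlgorithm p n X A W) (F : Ball n → Answer p n)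
    (ψ φ : X × A × W → ℂ) :
    B.oracleUnitary F (ψ - φ) = B.oracleUnitary F ψ - B.oracleUnitary F φ := rfl

open Classical in
/-- The part of the state `φ` in which the query register holds a point where the oracles `F` and
`G` differ. -/
def differPart (B : QuantumAlgorithm p n X A W) (F G : Ball n → Answer p n)
    (φ : X × A × W → ℂ) : X × A × W → ℂ :=
  fun z => if F (B.point z.1) = G (B.point z.1) then 0 else φ z

/-- Oracle unitaries preserve the query register, so the part of the state on points where the
oracles agree cancels. The triangle inequality on the rest gives the factor `2`. -/
theorem stateNorm_oracleUnitary_sub_le (B : QuantumAlgorithm p n X A W)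
    (F G : Ball n → Answer p n) (φ : X × A × W → ℂ) :
    stateNorm (B.oracleUnitary F φ - B.oracleUnitary G φ) ≤
      2 * stateNorm (B.differPart F G φ) := by
  have h : B.oracleUnitary F φ - B.oracleUnitary G φ =
      B.oracleUnitary F (B.differPart F G φ) - B.oracleUnitary G (B.differPart F G φ) := by
    funext z
    have e : ∀ H, B.oracleUnitary H (B.differPart F G φ) z =
        if F (B.point z.1) = G (B.point z.1) then 0 else B.oracleUnitary H φ z := fun _ => rfl
    rw [Pi.sub_apply, Pi.sub_apply, e, e]
    by_cases hz : F (B.point z.1) = G (B.point z.1)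
    · rw [if_pos hz, if_pos hz, sub_self, oracleUnitary, oracleUnitary, sub_eq_zero]
      simp only [oraclePerm, Equiv.coe_fn_symm_mk, hz]
    · rw [if_neg hz, if_neg hz]
  rw [h]
  refine (stateNorm_sub_le _ _).trans (le_of_eq ?_)
  rw [stateNorm_oracleUnitary, stateNorm_oracleUnitary]
  ring

/-- The state after `t` queries when the `j`-th query is answered by the oracle `O j`. -/
def hybridState (B : QuantumAlgorithm p n X A W) (O : ℕ → Ball n → Answer p n) :
    ℕ → X × A × W → ℂ
  | 0 => Matrix.mulVec (B.unitary 0).1 (Pi.single B.start 1)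
  | t + 1 => Matrix.mulVec (B.unitary (t + 1)).1 (B.oracleUnitary (O t) (hybridState B O t))

theorem stateNorm_hybridState (B : QuantumAlgorithm p n X A W) (O : ℕ → Ball n → Answer p n)
    (t : ℕ) : stateNorm (B.hybridState O t) = 1 := by
  induction t with
  | zero =>
    rw [hybridState, stateNorm_mulVec]
    exact (PiLp.norm_single 2 (fun _ => ℂ) B.start (1 : ℂ)).trans norm_one
  | succ t ih => rw [hybridState, stateNorm_mulVec, stateNorm_oracleUnitary, ih]

theorem hybridState_congr (B : QuantumAlgorithm p n X A W) (O O' : ℕ → Ball n → Answer p n)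
    (t : ℕ) (h : ∀ j < t, O j = O' j) : B.hybridState O t = B.hybridState O' t := by
  induction t with
  | zero => rfl
  | succ t ih => simp only [hybridState, ih fun j hj => h j (by omega), h t (by omega)]

/-- Unitaries carry earlier errors along without enlarging them, so each query adds only its own
error. That error is evaluated on the hybrid state, whose dependence on the frame is under control.
-/
theorem stateNorm_state_sub_hybridState_le (B : QuantumAlgorithm p n X A W)
    (F : Ball n → Answer p n) (O : ℕ → Ball n → Answer p n) (t : ℕ) :
    stateNorm (B.state F t - B.hybridState O t) ≤
      ∑ j ∈ Finset.range t, 2 * stateNorm (B.differPart F (O j) (B.hybridState O j)) := by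
  induction t with
  | zero => simp [state, hybridState, stateNorm]
  | succ t ih =>
    rw [Finset.sum_range_succ, state, hybridState, ← Matrix.mulVec_sub, stateNorm_mulVec]
    have h : B.oracleUnitary F (B.state F t) - B.oracleUnitary (O t) (B.hybridState O t) =
        B.oracleUnitary F (B.state F t - B.hybridState O t) +
          (B.oracleUnitary F (B.hybridState O t) - B.oracleUnitary (O t) (B.hybridState O t)) := by
      rw [oracleUnitary_sub]; abel
    rw [h]
    refine (stateNorm_add_le _ _).trans (add_le_add ?_ (B.stateNorm_oracleUnitary_sub_le _ _ _))
    rwa [stateNorm_oracleUnitary]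

open Classical in
-- Apply `(a + b)² ≤ 2a² + 2b²` to the amplitudes and Cauchy–Schwarz to the sum of the `t` query
-- errors. Squares are what turns errors into probabilities.
theorem probOf_le (B : QuantumAlgorithm p n X A W) (F : Ball n → Answer p n)
    (O : ℕ → Ball n → Answer p n) (t : ℕ) (good : Ball n → Prop) :
    B.probOf F t good ≤ 2 * (∑ z, if good (B.output z) then ‖B.hybridState O t z‖ ^ 2 else 0) +
      8 * t * ∑ j ∈ Finset.range t, ∑ z, if F (B.point z.1) = O j (B.point z.1) then 0
        else ‖B.hybridState O j z‖ ^ 2 := by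
  set φ := B.hybridState O with hφ
  have hdiff : stateNorm (B.state F t - φ t) ^ 2 ≤
      4 * t * ∑ j ∈ Finset.range t, ∑ z, if F (B.point z.1) = O j (B.point z.1) then 0
        else ‖φ j z‖ ^ 2 := by
    have h1 := pow_le_pow_left₀ (stateNorm_nonneg _) (B.stateNorm_state_sub_hybridState_le F O t) 2
    have h2 := sq_sum_le_card_mul_sum_sq (s := Finset.range t)
      (f := fun j => 2 * stateNorm (B.differPart F (O j) (φ j)))
    refine h1.trans (h2.trans (le_of_eq ?_))
    rw [Finset.card_range, mul_comm 4, mul_assoc, Finset.mul_sum _ _ (4 : ℝ)]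
    congr 1
    refine Finset.sum_congr rfl fun j _ => ?_
    rw [mul_pow, stateNorm_sq]
    norm_num
    refine Finset.sum_congr rfl fun z _ => ?_
    simp only [differPart]
    split_ifs <;> simp
  have hpt : B.probOf F t good ≤
      2 * (∑ z, if good (B.output z) then ‖φ t z‖ ^ 2 else 0) +
        2 * stateNorm (B.state F t - φ t) ^ 2 := by
    rw [stateNorm_sq, Finset.mul_sum, Finset.mul_sum, ← Finset.sum_add_distrib, probOf]
    refine Finset.sum_le_sum fun z _ => ?_
    split_ifs
    · have h1 : ‖B.state F t z‖ ≤ ‖φ t z‖ + ‖(B.state F t - φ t) z‖ := by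
        have := norm_add_le (φ t z) ((B.state F t - φ t) z)
        rwa [Pi.sub_apply, add_sub_cancel] at this
      have h2 := pow_le_pow_left₀ (norm_nonneg _) h1 2
      nlinarith [sq_nonneg (‖φ t z‖ - ‖(B.state F t - φ t) z‖)]
    · positivity
  linarith

theorem measurable_hybridState (B : QuantumAlgorithm p n X A W) {Y : Type*} [MeasurableSpace Y]
    (O : Y → ℕ → Ball n → Answer p n) (hO : ∀ j x, Measurable fun y => O y j x) (t : ℕ) :
    ∀ z, Measurable fun y => B.hybridState (O y) t z := by
  induction t with
  | zero => exact fun z => measurable_const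
  | succ t ih =>
    intro z
    simp only [hybridState, Matrix.mulVec, dotProduct]
    refine Finset.measurable_sum _ fun z' _ => Measurable.const_mul ?_ _
    -- The encoded answer takes finitely many values, so the parameter space splits into measurable
    -- pieces on which the permutation is fixed at `z'`.
    have h : (fun y => B.oracleUnitary (O y t) (B.hybridState (O y) t) z') = fun y =>
        ∑ a, (((fun y => O y t (B.point z'.1)) ⁻¹' (B.encode ⁻¹' {a})).indicator
          fun y => B.hybridState (O y) t (z'.1, z'.2.1 - a, z'.2.2)) y := by
      funext y
      rw [Finset.sum_eq_single (B.encode (O y t (B.point z'.1)))]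
      · rw [indicator_of_mem (by simp)]; rfl
      · intro a _ ha
        rw [indicator_of_notMem]
        simpa using fun h => ha h.symm
      · simp
    rw [h]
    exact Finset.measurable_sum _ fun a _ => (ih _).indicator (hO t _ (B.measurable_encode a))

open Classical in
theorem ofReal_probOf_le (B : QuantumAlgorithm p n X A W) {c : ℝ} (hc : 40 ≤ c) {t : ℕ}
    (ht : t < steps c n) {last : Fin (steps c n)} (hlast : (last : ℕ) + 1 = steps c n)
    {V : Fin (steps c n) → E n} (hV : Orthonormal ℝ V) :
    ENNReal.ofReal (B.probOf (oracle p (hardFun c p n V)) t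
        (IsEpsOptimal (eps c n) (hardFun c p n V))) ≤
      2 * (∑ z, if gam c n / 4 < |inner ℝ (V last) (B.output z : E n)| then
          ENNReal.ofReal (‖B.hybridState (hybridOracle c p n V) t z‖ ^ 2) else 0) +
      8 * t * ∑ j ∈ Finset.range t, ∑ z, ∑ i : Fin (steps c n),
        if j ≤ i ∧ gam c n / 4 < |inner ℝ (V i) (B.point z.1 : E n)| then
          ENNReal.ofReal (‖B.hybridState (hybridOracle c p n V) j z‖ ^ 2) else 0 := by
  have h : 0 < steps c n := Nat.zero_lt_of_lt ht
  refine (ENNReal.ofReal_le_ofReal (B.probOf_le _ (hybridOracle c p n V) t _)).trans ?_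
  have hite : ∀ (q : Prop) [Decidable q] (r : ℝ), 0 ≤ r → 0 ≤ if q then r else 0 := fun q _ r hr => by
    split_ifs <;> simp [hr]
  have hite' : ∀ (q : Prop) [Decidable q] (r : ℝ), 0 ≤ r → 0 ≤ if q then 0 else r := fun q _ r hr => by
    split_ifs <;> simp [hr]
  rw [ENNReal.ofReal_add
      (mul_nonneg zero_le_two (Finset.sum_nonneg fun z _ => hite _ _ (by positivity)))
      (mul_nonneg (by positivity) (Finset.sum_nonneg fun j _ => Finset.sum_nonneg fun z _ =>
        hite' _ _ (by positivity))),
    ENNReal.ofReal_mul zero_le_two, ENNReal.ofReal_mul (by positivity),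
    ENNReal.ofReal_sum_of_nonneg (fun z _ => hite _ _ (by positivity)),
    ENNReal.ofReal_sum_of_nonneg (fun j _ => Finset.sum_nonneg fun z _ =>
        hite' _ _ (by positivity)),
    ENNReal.ofReal_mul (by norm_num), ENNReal.ofReal_ofNat, ENNReal.ofReal_ofNat,
    ENNReal.ofReal_natCast]
  gcongr with z _ j hj
  · split_ifs with h1 h2
    · exact le_rfl
    · exact absurd h1 (not_isEpsOptimal_hardFun hc h hV _ hlast (not_lt.1 h2))
    · simp
    · simp
  · rw [ENNReal.ofReal_sum_of_nonneg (fun z _ => hite' _ _ (by positivity))]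
    refine Finset.sum_le_sum fun z _ => ?_
    split_ifs with h1
    · simp
    · have : ∃ i : Fin (steps c n), j ≤ i ∧
          gam c n / 4 < |inner ℝ (V i) (B.point z.1 : E n)| := by
        by_contra! hcon
        exact h1 (oracle_hardFun_truncV hc h (fun i => (hV.1 i).le)
          ((Finset.mem_range.1 hj).trans ht) _ hcon)
      obtain ⟨i, hi⟩ := this
      refine le_trans ?_ (Finset.single_le_sum (fun _ _ => zero_le) (Finset.mem_univ i))
      rw [if_pos hi]

/-- The squared amplitude `w j z` is the weight in the tail bound, against the fixed point encoded
by `z`. For each `j` the weights sum to one, so the size of the registers does not enter. -/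
theorem success_le (B : QuantumAlgorithm p n X A W) {c : ℝ} (hc : 40 ≤ c) {t : ℕ}
    (ht : t < steps c n) :
    B.success t c ≤ (2 + 8 * t * (t * steps c n) : ℕ) * ENNReal.ofReal (tailBound c n) := by
  classical
  have h : 0 < steps c n := Nat.zero_lt_of_lt ht
  obtain ⟨-, -, hkn⟩ := dim_facts_of_steps_pos hc h
  have hlt : steps c n - 1 < steps c n := Nat.sub_lt h zero_lt_one
  set last : Fin (steps c n) := ⟨steps c n - 1, hlt⟩ with hlast
  have hlast1 : (last : ℕ) + 1 = steps c n := Nat.sub_add_cancel h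
  have hO : ∀ j x, Measurable fun V => hybridOracle c p n V j x := by
    intro j x
    have h1 := measurable_hybridOracle (p := p) hc h j
    have h2 := h1.comp (measurable_prodMk_right (y := x))
    exact h2
  set w : ℕ → X × A × W → (Fin (steps c n) → E n) → ℝ≥0∞ := fun j z V =>
    ENNReal.ofReal (‖B.hybridState (hybridOracle c p n V) j z‖ ^ 2) with hw
  have hwm : ∀ j z, Measurable (w j z) := fun j z =>
    ((B.measurable_hybridState _ hO j z).norm.pow_const 2).ennreal_ofReal
  have hwd : ∀ j z, DependsOn (w j z) {i | (i : ℕ) < j} := by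
    intro j z V V' hV
    simp only [hw]
    rw [B.hybridState_congr _ _ j fun i hi => hybridOracle_congr hV hi]
  have hw1 : ∀ j, ∑ z, ∫⁻ V, w j z V ∂haarFrame n (steps c n) = 1 := by
    intro j
    rw [← lintegral_finsetSum _ fun z _ => hwm j z]
    have : ∀ V, ∑ z, w j z V = 1 := by
      intro V
      simp only [hw]
      rw [← ENNReal.ofReal_sum_of_nonneg fun z _ => by positivity, ← stateNorm_sq,
        stateNorm_hybridState]
      simp
    simp [this]
  have hind : ∀ (i : Fin (steps c n)) (x : Ball n) (j : ℕ) (z : X × A × W),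
      Measurable fun V : Fin (steps c n) → E n =>
        if gam c n / 4 < |inner ℝ (V i) (x : E n)| then w j z V else 0 := by
    intro i x j z
    refine Measurable.ite ?_ (hwm j z) measurable_const
    exact measurableSet_lt measurable_const (continuous_abs.measurable.comp
      ((measurable_pi_apply i).inner measurable_const))
  have htail : ∀ (i : Fin (steps c n)) (x : Ball n) (j : ℕ) (z : X × A × W), j ≤ i →
      ∫⁻ V, (if gam c n / 4 < |inner ℝ (V i) (x : E n)| then w j z V else 0)
        ∂haarFrame n (steps c n) ≤
      ENNReal.ofReal (tailBound c n) * ∫⁻ V, w j z V ∂haarFrame n (steps c n) := by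
    intro i x j z hji
    refine le_trans (le_of_eq (lintegral_congr fun V => ?_)) (lintegral_indicator_inner_gam_le hc h i
      hji (w j z) (hwm j z) (hwd j z) (fun _ => x) measurable_const fun _ _ _ => rfl)
    by_cases hV : gam c n / 4 < |inner ℝ (V i) (x : E n)|
    · rw [if_pos hV, indicator_of_mem (by exact hV)]
    · rw [if_neg hV, indicator_of_notMem (by exact hV)]
  have hand : ∀ (j : ℕ) (i : Fin (steps c n)) (z : X × A × W) (V : Fin (steps c n) → E n),
      (if j ≤ i ∧ gam c n / 4 < |inner ℝ (V i) (B.point z.1 : E n)| then w j z V else 0) =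
      if j ≤ i then (if gam c n / 4 < |inner ℝ (V i) (B.point z.1 : E n)| then w j z V else 0)
        else 0 := fun j i z V => by
    by_cases h1 : j ≤ i <;> simp [h1]
  have handm : ∀ (j : ℕ) (i : Fin (steps c n)) (z : X × A × W),
      Measurable fun V : Fin (steps c n) → E n =>
        if j ≤ i ∧ gam c n / 4 < |inner ℝ (V i) (B.point z.1 : E n)| then w j z V else 0 := by
    intro j i z
    simp only [hand]
    by_cases h1 : j ≤ i
    · simpa only [h1, if_true] using hind i (B.point z.1) j z
    · simp [h1]
  have hand_le : ∀ (j : ℕ) (i : Fin (steps c n)) (z : X × A × W),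
      ∫⁻ V, (if j ≤ i ∧ gam c n / 4 < |inner ℝ (V i) (B.point z.1 : E n)| then w j z V else 0)
        ∂haarFrame n (steps c n) ≤
      ENNReal.ofReal (tailBound c n) * ∫⁻ V, w j z V ∂haarFrame n (steps c n) := by
    intro j i z
    simp only [hand]
    by_cases h1 : j ≤ i
    · simpa only [h1, if_true] using htail i (B.point z.1) j z h1
    · simp [h1]
  have hbound : B.success t c ≤ ∫⁻ V,
      (2 * (∑ z, if gam c n / 4 < |inner ℝ (V last) (B.output z : E n)| then w t z V else 0) +
      8 * t * ∑ j ∈ Finset.range t, ∑ z, ∑ i : Fin (steps c n),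
        if j ≤ i ∧ gam c n / 4 < |inner ℝ (V i) (B.point z.1 : E n)| then w j z V else 0)
      ∂haarFrame n (steps c n) := by
    refine lintegral_mono_ae ?_
    filter_upwards [ae_orthonormal_haarFrame (n := n) (k := steps c n) (by omega)] with V hV
    exact B.ofReal_probOf_le hc ht hlast1 hV
  refine hbound.trans ?_
  have hm1 : Measurable fun V : Fin (steps c n) → E n =>
      ∑ z, if gam c n / 4 < |inner ℝ (V last) (B.output z : E n)| then w t z V else 0 :=
    Finset.measurable_sum _ fun z _ => hind last (B.output z) t z
  have hm2 : ∀ (j : ℕ) (z : X × A × W), Measurable fun V : Fin (steps c n) → E n => ∑ i : Fin (steps c n),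
      if j ≤ i ∧ gam c n / 4 < |inner ℝ (V i) (B.point z.1 : E n)| then w j z V else 0 :=
    fun j z => Finset.measurable_sum _ fun i _ => handm j i z
  have hm3 : ∀ j : ℕ, Measurable fun V : Fin (steps c n) → E n => ∑ z, ∑ i : Fin (steps c n),
      if j ≤ i ∧ gam c n / 4 < |inner ℝ (V i) (B.point z.1 : E n)| then w j z V else 0 :=
    fun j => Finset.measurable_sum _ fun z _ => hm2 j z
  rw [lintegral_add_left (hm1.const_mul 2), lintegral_const_mul _ hm1,
    lintegral_const_mul _ (Finset.measurable_sum _ fun j _ => hm3 j),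
    lintegral_finsetSum _ fun z _ => hind last (B.output z) t z,
    lintegral_finsetSum _ fun j _ => hm3 j]
  have hle1 : ∑ z, ∫⁻ V, (if gam c n / 4 < |inner ℝ (V last) (B.output z : E n)| then w t z V
      else 0) ∂haarFrame n (steps c n) ≤ ENNReal.ofReal (tailBound c n) := by
    calc _ ≤ ∑ z, ENNReal.ofReal (tailBound c n) * ∫⁻ V, w t z V ∂haarFrame n (steps c n) :=
          Finset.sum_le_sum fun z _ => htail last (B.output z) t z
            (Nat.le_of_lt_succ (by rw [hlast1.symm] at ht; exact ht))
      _ = _ := by rw [← Finset.mul_sum, hw1, mul_one]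
  have hle2 : ∀ j : ℕ, ∫⁻ V, (∑ z, ∑ i : Fin (steps c n),
      if j ≤ i ∧ gam c n / 4 < |inner ℝ (V i) (B.point z.1 : E n)| then w j z V else 0)
        ∂haarFrame n (steps c n) ≤ steps c n * ENNReal.ofReal (tailBound c n) := by
    intro j
    rw [lintegral_finsetSum _ fun z _ => hm2 j z]
    calc _ ≤ ∑ z, steps c n * (ENNReal.ofReal (tailBound c n) *
          ∫⁻ V, w j z V ∂haarFrame n (steps c n)) := by
          refine Finset.sum_le_sum fun z _ => ?_
          rw [lintegral_finsetSum _ fun i _ => handm j i z]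
          refine (Finset.sum_le_sum fun i _ => hand_le j i z).trans (le_of_eq ?_)
          simp
      _ = _ := by rw [← Finset.mul_sum, ← Finset.mul_sum, hw1, mul_one]
  calc _ ≤ 2 * ENNReal.ofReal (tailBound c n) + 8 * t * ∑ _j ∈ Finset.range t,
        (steps c n * ENNReal.ofReal (tailBound c n)) := by
        gcongr with j hj
        exact hle2 j
    _ = _ := by
        rw [Finset.sum_const, Finset.card_range, nsmul_eq_mul]
        push_cast
        ring

/-- Fewer than `k` queries give success probability at most `n⁻⁴`. -/
theorem success_le_inv (B : QuantumAlgorithm p n X A W) {c : ℝ} (hc : 40 ≤ c) {t : ℕ}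
    (ht : t < steps c n) : B.success t c ≤ ENNReal.ofReal (1 / (n : ℝ) ^ 4) := by
  refine (B.success_le hc ht).trans ?_
  obtain ⟨-, hn, hkn⟩ := dim_facts_of_steps_pos hc (Nat.zero_lt_of_lt ht)
  have hn0 : (0 : ℝ) < n := by positivity
  rw [← ENNReal.ofReal_natCast, ← ENNReal.ofReal_mul (by positivity)]
  refine ENNReal.ofReal_le_ofReal ?_
  -- The exponent `c²/64` is at least `25`; nine powers suffice, since the count `2n³` and the
  -- factors `2 ≤ n` use up five.
  have htl := tailBound_le (c := c) (n := n) (by omega) (N := 9) (by push_cast; nlinarith)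
  have hcount : 2 + 8 * t * (t * steps c n) ≤ 2 * n ^ 3 := by
    have h1 : 8 * t * (t * steps c n) ≤ n ^ 3 := by
      calc 8 * t * (t * steps c n) = (2 * t) * ((2 * t) * (2 * steps c n)) := by ring
        _ ≤ n * (n * n) := by gcongr <;> omega
        _ = n ^ 3 := by ring
    have h2 : 2 ^ 3 ≤ n ^ 3 := by gcongr
    omega
  have hcount' : ((2 + 8 * t * (t * steps c n) : ℕ) : ℝ) ≤ 2 * n ^ 3 := by exact_mod_cast hcount
  have hn2 : (2 : ℝ) ≤ n := by exact_mod_cast hn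
  calc _ ≤ (2 * (n : ℝ) ^ 3) * (2 / (n : ℝ) ^ 9) :=
        mul_le_mul hcount' htl (tailBound_nonneg _ _) (by positivity)
    _ ≤ (n * (n : ℝ) ^ 3) * (n / (n : ℝ) ^ 9) := by gcongr
    _ = 1 / (n : ℝ) ^ 4 := by field_simp

end QuantumAlgorithm

end SmoothLB

end

theorem mainTheorem7 :
    (∀ (p n K r : ℕ), 1 ≤ p → 1 ≤ K →
      ∀ (Ω : Type*) [MeasurableSpace Ω] (P : Measure Ω) [IsProbabilityMeasure P]
        (A : ParallelAlgorithm p n K r Ω),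
        ENNReal.ofReal ((K : ℝ) / (n : ℝ) ^ 9) < A.success P 40 → steps 40 n ≤ r) ∧
    (∀ d : ℕ, ∃ c : ℝ, 40 ≤ c ∧ ∀ (p n K r : ℕ), 1 ≤ p → 1 ≤ K →
      ∀ (Ω : Type*) [MeasurableSpace Ω] (P : Measure Ω) [IsProbabilityMeasure P]
        (A : ParallelAlgorithm p n K r Ω),
        ENNReal.ofReal ((K : ℝ) / (n : ℝ) ^ d) < A.success P c → steps c n ≤ r) ∧
    (∀ (p n t : ℕ), 1 ≤ p →
      ∀ (X A W : Type) [Fintype X] [DecidableEq X] [Fintype A] [DecidableEq A] [AddCommGroup A]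
        [Fintype W] [DecidableEq W] (B : QuantumAlgorithm p n X A W),
        ENNReal.ofReal (1 / (n : ℝ) ^ 4) < B.success t 40 → steps 40 n ≤ t) := by
  -- The choice `c = 40 + d` works because `(40 + d)²/64 ≥ 25 + 5d/4 ≥ d + 4`.
  refine ⟨fun p n K r _ hK Ω _ P _ A hA => ?_, fun d => ⟨40 + d, by simp, ?_⟩,
    fun p n t _ X A W _ _ _ _ _ _ _ B hB => ?_⟩
  · by_contra! hr
    exact hA.not_ge (A.success_le_div P le_rfl (by norm_num) hK hr)
  · intro p n K r _ hK Ω _ P _ A hA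
    by_contra! hr
    have hd : (0 : ℝ) ≤ d := d.cast_nonneg
    exact hA.not_ge (A.success_le_div P (by linarith) (by nlinarith) hK hr)
  · by_contra! ht
    exact hB.not_ge (B.success_le_inv le_rfl ht)
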